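/- Let $1\le k\le n$ be integers and let $f:\mathbb{R}^n\to\mathbb{R}$ satisfy: (i) $f$ is $L$-smooth for some $L>0$, i.e. continuously differentiable with $\|\nabla f(x)-\nabla f(y)\|\le L\|x-y\|$ for all $x,y$; (ii) $f$ is a Łojasiewicz function with exponent $\theta\in(0,1)$, i.e. for every $x^*$ with $\nabla f(x^*)=0$ there are $\kappa,\mu>0$ such that $|f(x)-f(x^*)|^{\theta}\le\kappa\|\nabla f(x)\|$ whenever $\|x-x^*\|\le\mu$; (iii) $\inf f>-\infty$. Let $x_0\in\mathbb{R}^n$, $\delta_0\in(0,1]$, $\delta_t=\delta_0 2^{-t}$, $\eta\in\left(0,\frac{2k}{Ln}\right)$, let $V_t=[v_{t,1},\dots,v_{t,k}]$, $t=0,1,2,\dots$, be independent and uniformly distributed on the Stiefel manifold $\mathrm{St}(n,k)=\{V\in\mathbb{R}^{n\times k}: V^\top V=I_k\}$, and let $(x_t)$ be the sequence generated by stochastic zeroth-order gradient descent (SZGD), $$x_{t+1}=x_t-\eta\,\frac{n}{2\delta_t k}\sum_{i=1}^k\bigl(f(x_t+\delta_t v_{t,i})-f(x_t-\delta_t v_{t,i})\bigr)v_{t,i},\qquad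 t=0,1,2,\dots$$ Assume that (iv) $(x_t)$ is bounded with probability 1. Then $(x_t)$ converges almost surely to a random critical point $x_\infty$ of $f$, and: (a) If $\theta\in(0,\frac12]$ and $-1\le\frac{Ln\eta^2}{2k}-\eta<0$, then $(\|x_t-x_\infty\|)$ converges to $0$ linearly almost surely: if the constant $\kappa$ in (ii) can be chosen independently of the critical point $x^*$ (for instance under the normalization $\kappa=1$), there is a non-random constant $Q>1$ such that $Q^t\|x_t-x_\infty\|\to0$ almost surely; and if $\kappa$ depends on $x^*$, then almost surely there is a $Q>1$, which may depend on the realization, with $Q^t\|x_t-x_\infty\|\to0$. (b) If $\theta\in(\frac12,1)$, then almost surely $\|x_t-x_\infty\|=O\bigl(t^{\frac{1-\theta}{1-2\theta}}\bigr)$ as $t\to\infty$ (the implied constant may depend on the realization). -/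

import Mathlib

open MeasureTheory ProbabilityTheory Filter Topology Asymptotics

noncomputable section

/-! Smooth functions and the Lojasiewicz inequality on `ℝⁿ`. -/

/-- `f` is continuously differentiable with an `L`-Lipschitz gradient. -/
def IsLSmooth {n : ℕ} (f : EuclideanSpace ℝ (Fin n) → ℝ) (L : ℝ) : Prop :=
  ContDiff ℝ 1 f ∧ ∀ x y, ‖gradient f x - gradient f y‖ ≤ L * ‖x - y‖

/-- The Lojasiewicz inequality with exponent `θ` and constant `κ` on some ball around `p`. -/
def LojasiewiczAt {n : ℕ} (f : EuclideanSpace ℝ (Fin n) → ℝ) (θ κ : ℝ)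
    (p : EuclideanSpace ℝ (Fin n)) : Prop :=
  ∃ μ : ℝ, 0 < μ ∧ ∀ x, ‖x - p‖ ≤ μ → |f x - f p| ^ θ ≤ κ * ‖gradient f x‖

/-- `f` is a (differentiable) Lojasiewicz function with exponent `θ`: the Lojasiewicz inequality
holds around every critical point, with constants that may depend on the point. -/
def IsLojasiewicz {n : ℕ} (f : EuclideanSpace ℝ (Fin n) → ℝ) (θ : ℝ) : Prop :=
  Differentiable ℝ f ∧ ∀ p, gradient f p = 0 → ∃ κ : ℝ, 0 < κ ∧ LojasiewiczAt f θ κ p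

/-- As `IsLojasiewicz`, with one constant `κ` for all critical points (the normalised inequality
is the case `κ = 1`). The radius of the ball may still depend on the point. -/
def IsLojasiewiczWith {n : ℕ} (f : EuclideanSpace ℝ (Fin n) → ℝ) (θ κ : ℝ) : Prop :=
  Differentiable ℝ f ∧ ∀ p, gradient f p = 0 → LojasiewiczAt f θ κ p

/-! The uniform distribution on the Stiefel manifold. -/

/-- The orthogonal group is compact. -/
theorem isCompact_orthogonalGroup (n : ℕ) :
    IsCompact (Matrix.orthogonalGroup (Fin n) ℝ : Set (Matrix (Fin n) (Fin n) ℝ)) := by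
  have hsub : (Matrix.orthogonalGroup (Fin n) ℝ : Set (Matrix (Fin n) (Fin n) ℝ)) ⊆
      Set.pi Set.univ (fun _ => Set.pi Set.univ (fun _ => Set.Icc (-1 : ℝ) 1)) := by
    intro U hU i _ j _
    have h := entry_norm_bound_of_unitary (𝕜 := ℝ) hU i j
    rw [Real.norm_eq_abs] at h
    exact abs_le.mp h
  have hcl : IsClosed
      (Matrix.orthogonalGroup (Fin n) ℝ : Set (Matrix (Fin n) (Fin n) ℝ)) := by
    have : (Matrix.orthogonalGroup (Fin n) ℝ : Set (Matrix (Fin n) (Fin n) ℝ)) =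
        {U | U * star U = 1} := by
      ext U
      exact Matrix.mem_orthogonalGroup_iff (Fin n) ℝ
    rw [this]
    exact isClosed_eq (by fun_prop) continuous_const
  exact (isCompact_univ_pi fun _ => isCompact_univ_pi fun _ => isCompact_Icc).of_isClosed_subset
    hcl hsub

instance instCompactSpaceOrthogonalGroup (n : ℕ) :
    CompactSpace (Matrix.orthogonalGroup (Fin n) ℝ) :=
  isCompact_iff_compactSpace.mp (isCompact_orthogonalGroup n)

instance instMeasurableSpaceOrthogonalGroup (n : ℕ) :
    MeasurableSpace (Matrix.orthogonalGroup (Fin n) ℝ) := borel _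

instance instBorelSpaceOrthogonalGroup (n : ℕ) :
    BorelSpace (Matrix.orthogonalGroup (Fin n) ℝ) := ⟨rfl⟩

/-- The first `k` columns of an orthogonal matrix, an orthonormal `k`-frame of `ℝⁿ`, that is, a
point of the Stiefel manifold `St(n, k)`. -/
def frameOf {n k : ℕ} (hkn : k ≤ n) (U : Matrix.orthogonalGroup (Fin n) ℝ) :
    Fin k → EuclideanSpace ℝ (Fin n) :=
  fun i => WithLp.toLp 2 (fun r => (U : Matrix (Fin n) (Fin n) ℝ) r (Fin.castLE hkn i))

/-- The uniform distribution on the Stiefel manifold `St(n, k)`, as a measure on `k`-tuples of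
vectors: the image of the Haar probability measure of the orthogonal group `O(n)` under
`O(n) → St(n, k)`. It is the unique rotation invariant probability measure on `St(n, k)`. -/
def stiefelUniform {n k : ℕ} (hkn : k ≤ n) : Measure (Fin k → EuclideanSpace ℝ (Fin n)) :=
  (Measure.haarMeasure (⊤ : TopologicalSpace.PositiveCompacts
    (Matrix.orthogonalGroup (Fin n) ℝ))).map (frameOf hkn)

/-! The algorithm. -/

/-- The gradient estimator with directions `v₁, …, v_k` and finite difference granularity `δ`. -/
def gradEst {n k : ℕ} (f : EuclideanSpace ℝ (Fin n) → ℝ) (δ : ℝ)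
    (v : Fin k → EuclideanSpace ℝ (Fin n)) (x : EuclideanSpace ℝ (Fin n)) :
    EuclideanSpace ℝ (Fin n) :=
  ((n : ℝ) / (2 * δ * k)) • ∑ i, (f (x + δ • v i) - f (x - δ • v i)) • v i

/-- The iterates of stochastic zeroth-order gradient descent with constant step size `η`, initial
granularity `δ₀` (halved in every step), starting point `x₀`, and the frame `v t` in step `t`. -/
def szgd {n k : ℕ} (f : EuclideanSpace ℝ (Fin n) → ℝ) (η δ₀ : ℝ)
    (x₀ : EuclideanSpace ℝ (Fin n)) (v : ℕ → Fin k → EuclideanSpace ℝ (Fin n)) :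
    ℕ → EuclideanSpace ℝ (Fin n)
  | 0 => x₀
  | t + 1 => szgd f η δ₀ x₀ v t - η • gradEst f (δ₀ / 2 ^ t) (v t) (szgd f η δ₀ x₀ v t)

end

/-!
One step of the algorithm with an orthonormal frame `v` is a step along the projection of the
gradient to the span of `v`, up to an error of order `δ_t`. As `L * n * η < 2 * k`, the energy
`f (x t) + H / 4 ^ t` decreases by at least `a * (R t * ‖∇f (x t)‖ ^ 2 + 1 / 4 ^ t)`, where `R t` is
the squared length of the projection of the direction of the gradient. Given the past, the law of
`R t` does not depend on that direction, since the frame is rotation invariant. So the `R t` are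
independent and identically distributed with mean `k / n`, and their averages converge to `k / n`
almost surely.

The rest is deterministic. The Łojasiewicz inequality turns the decrease into the recursion
`E (t + 1) ≤ E t - c * R t * E t ^ (2 * θ)` for the gap `E t` between the energy and its limit, and
the averages of the `R t` make its solutions decay as if `R t` were constant: exponentially if
`θ ≤ 1 / 2`, and like `t ^ (-1 / (2 * θ - 1))` otherwise. Squared step lengths are bounded by energy
decrements. Applied to single steps in the first case, and by Cauchy–Schwarz to the blocks
`[t, 2 * t]` in the second, this bounds the distance to the limit. Near a point that is not critical
the Łojasiewicz inequality is trivial, so the convergence of `x t` follows without knowing that the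
gradients tend to zero. If the gradient at the limit were nonzero, the `R t` would tend to zero,
contrary to their positive average.
-/

section LipschitzDerivative

variable {E G : Type*} [NormedAddCommGroup E] [NormedSpace ℝ E] [NormedAddCommGroup G]
  [NormedSpace ℝ G] {f : E → G} {f' : E → E →L[ℝ] G} {L : ℝ}

theorem norm_add_sub_sub_le_of_lipschitz_fderiv (hf : ∀ x, HasFDerivAt f (f' x) x)
    (hL : ∀ x y, ‖f' x - f' y‖ ≤ L * ‖x - y‖) (x v : E) :
    ‖f (x + v) - f x - f' x v‖ ≤ L / 2 * ‖v‖ ^ 2 := by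
  have hline (s : ℝ) : HasDerivAt (fun s : ℝ => f (x + s • v) - f x - s • f' x v)
      (f' (x + s • v) v - f' x v) s := by
    have hs : HasDerivAt (fun s : ℝ => x + s • v) v s := by
      simpa only [one_smul] using ((hasDerivAt_id' s).smul_const v).const_add x
    exact (((hf _).comp_hasDerivAt s hs).sub_const _).sub
      (((hasDerivAt_id' s).smul_const (f' x v)).congr_deriv (one_smul ℝ _))
  have hquad (s : ℝ) : HasDerivAt (fun s : ℝ => L / 2 * ‖v‖ ^ 2 * s ^ 2) (L * ‖v‖ ^ 2 * s) s := by
    refine ((hasDerivAt_pow 2 s).const_mul (L / 2 * ‖v‖ ^ 2)).congr_deriv ?_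
    push_cast
    ring
  have hbound : ∀ s ∈ Set.Ico (0 : ℝ) 1, ‖f' (x + s • v) v - f' x v‖ ≤ L * ‖v‖ ^ 2 * s := by
    intro s hs
    calc ‖f' (x + s • v) v - f' x v‖ ≤ ‖f' (x + s • v) - f' x‖ * ‖v‖ :=
          (f' (x + s • v) - f' x).le_opNorm v
      _ ≤ L * ‖x + s • v - x‖ * ‖v‖ := by gcongr; exact hL _ _
      _ = L * ‖v‖ ^ 2 * s := by
          rw [add_sub_cancel_left, norm_smul, Real.norm_of_nonneg hs.1]
          ring
  simpa only [one_smul, one_pow, mul_one] using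
    image_norm_le_of_norm_deriv_right_le_deriv_boundary
      (fun s _ => (hline s).continuousAt.continuousWithinAt)
      (fun s _ => (hline s).hasDerivWithinAt) (by simp) hquad hbound
      (Set.right_mem_Icc.2 zero_le_one)

theorem norm_add_sub_sub_sub_two_smul_le_of_lipschitz_fderiv (hf : ∀ x, HasFDerivAt f (f' x) x)
    (hL : ∀ x y, ‖f' x - f' y‖ ≤ L * ‖x - y‖) (x v : E) :
    ‖f (x + v) - f (x - v) - (2 : ℝ) • f' x v‖ ≤ L * ‖v‖ ^ 2 := by
  have hpos := norm_add_sub_sub_le_of_lipschitz_fderiv hf hL x v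
  have hneg := norm_add_sub_sub_le_of_lipschitz_fderiv hf hL x (-v)
  rw [map_neg, norm_neg, ← sub_eq_add_neg] at hneg
  calc ‖f (x + v) - f (x - v) - (2 : ℝ) • f' x v‖
      = ‖(f (x + v) - f x - f' x v) - (f (x - v) - f x - -f' x v)‖ := by
        rw [two_smul]
        congr 1
        abel
    _ ≤ L / 2 * ‖v‖ ^ 2 + L / 2 * ‖v‖ ^ 2 := (norm_sub_le _ _).trans (add_le_add hpos hneg)
    _ = L * ‖v‖ ^ 2 := by ring

end LipschitzDerivative

/-- The symmetric difference quotient of `f` at `x` in the direction `v`, the summand of the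
gradient estimator `gradEst`. -/
noncomputable def centralDifference {E : Type*} [AddCommGroup E] [Module ℝ E] (f : E → ℝ) (δ : ℝ)
    (x v : E) : ℝ :=
  (f (x + δ • v) - f (x - δ • v)) / (2 * δ)

namespace IsLSmooth

variable {n : ℕ} {f : EuclideanSpace ℝ (Fin n) → ℝ} {L : ℝ}

theorem norm_fderiv_sub_le (hf : IsLSmooth f L) (x y : EuclideanSpace ℝ (Fin n)) :
    ‖fderiv ℝ f x - fderiv ℝ f y‖ ≤ L * ‖x - y‖ := by
  rw [← LinearIsometryEquiv.norm_map (InnerProductSpace.toDual ℝ _).symm, map_sub]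
  exact hf.2 x y

theorem hasFDerivAt (hf : IsLSmooth f L) (x : EuclideanSpace ℝ (Fin n)) :
    HasFDerivAt f (fderiv ℝ f x) x :=
  (hf.1.differentiable one_ne_zero x).hasFDerivAt

theorem continuous_gradient (hf : IsLSmooth f L) : Continuous (gradient f) :=
  (InnerProductSpace.toDual ℝ _).symm.continuous.comp (hf.1.continuous_fderiv one_ne_zero)

theorem apply_add_le (hf : IsLSmooth f L) (x v : EuclideanSpace ℝ (Fin n)) :
    f (x + v) ≤ f x + inner ℝ (gradient f x) v + L / 2 * ‖v‖ ^ 2 := by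
  have h := norm_add_sub_sub_le_of_lipschitz_fderiv hf.hasFDerivAt hf.norm_fderiv_sub_le x v
  rw [← inner_gradient_left] at h
  linarith [(abs_le.1 h).2]

theorem abs_centralDifference_sub_inner_le (hf : IsLSmooth f L) {δ : ℝ} (hδ : 0 < δ)
    (x v : EuclideanSpace ℝ (Fin n)) :
    |centralDifference f δ x v - inner ℝ (gradient f x) v| ≤ L / 2 * δ * ‖v‖ ^ 2 := by
  have h := norm_add_sub_sub_sub_two_smul_le_of_lipschitz_fderiv hf.hasFDerivAt
    hf.norm_fderiv_sub_le x (δ • v)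
  rw [← inner_gradient_left, inner_smul_right, norm_smul, Real.norm_of_nonneg hδ.le,
    Real.norm_eq_abs, smul_eq_mul] at h
  have hquot : centralDifference f δ x v - inner ℝ (gradient f x) v =
      (f (x + δ • v) - f (x - δ • v) - 2 * (δ * inner ℝ (gradient f x) v)) / (2 * δ) := by
    rw [centralDifference]
    field_simp
  rw [hquot, abs_div, abs_of_pos (by positivity : 0 < 2 * δ), div_le_iff₀ (by positivity)]
  linarith

end IsLSmooth

section ProjectedStep

variable {F ι : Type*} [NormedAddCommGroup F] [InnerProductSpace ℝ F] [Fintype ι]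

/-- The squared norm of the orthogonal projection of `u` to the span of the orthonormal family
`v`. It governs the progress that a step in the directions `v` makes when the gradient is `u`. -/
noncomputable def projSq (v : ι → F) (u : F) : ℝ :=
  ∑ i, inner ℝ u (v i) ^ 2

theorem projSq_nonneg (v : ι → F) (u : F) : 0 ≤ projSq v u :=
  Finset.sum_nonneg fun _ _ => sq_nonneg _

theorem projSq_le_norm_sq {v : ι → F} (hv : Orthonormal ℝ v) (u : F) : projSq v u ≤ ‖u‖ ^ 2 := by
  simpa only [projSq, real_inner_comm, Real.norm_eq_abs, sq_abs] using
    hv.sum_inner_products_le u (s := Finset.univ)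

theorem projSq_smul (v : ι → F) (r : ℝ) (u : F) : projSq v (r • u) = r ^ 2 * projSq v u := by
  simp only [projSq, real_inner_smul_left, mul_pow, Finset.mul_sum]

theorem sum_projSq_orthonormalBasis {κ : Type*} [Fintype κ] (v : ι → F)
    (b : OrthonormalBasis κ ℝ F) : ∑ j, projSq v (b j) = ∑ i, ‖v i‖ ^ 2 := by
  simp only [projSq]
  rw [Finset.sum_comm]
  simp only [b.sum_sq_inner_right]

theorem projSq_comp_linearIsometryEquiv (φ : F ≃ₗᵢ[ℝ] F) (v : ι → F) (u : F) :
    projSq (fun i => φ (v i)) u = projSq v (φ.symm u) := by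
  simp only [projSq, ← φ.symm.inner_map_map u, φ.symm_apply_apply]

theorem norm_sum_smul_sq_of_orthonormal {v : ι → F} (hv : Orthonormal ℝ v) (w : ι → ℝ) :
    ‖∑ i, w i • v i‖ ^ 2 = ∑ i, w i ^ 2 := by
  rw [← real_inner_self_eq_norm_sq, hv.inner_sum]
  simp only [conj_trivial, sq]

theorem neg_mul_add_mul_sq_le {A : ℝ} (hA₀ : 0 < A) (hA₁ : A < 1) (c w : ℝ) :
    -(c * w) + A * w ^ 2 ≤
      -((1 - A) / 2 * c ^ 2) + (1 / (2 * (1 - A)) + 1) * (w - c) ^ 2 := by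
  have hA : 0 < 1 - A := by linarith
  have hnonneg : 0 ≤ (((1 - A) * c + (1 - 2 * A) * (w - c)) ^ 2 +
      2 * (1 - A) * (1 + A) * (w - c) ^ 2) / (2 * (1 - A)) := by positivity
  have hdiff : -((1 - A) / 2 * c ^ 2) + (1 / (2 * (1 - A)) + 1) * (w - c) ^ 2 -
      (-(c * w) + A * w ^ 2) = (((1 - A) * c + (1 - 2 * A) * (w - c)) ^ 2 +
        2 * (1 - A) * (1 + A) * (w - c) ^ 2) / (2 * (1 - A)) := by
    field_simp
    ring
  linarith

-- The coefficients `w i` stand for inexact values of `⟪g, v i⟫`.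
theorem apply_sub_smul_sum_le {f : F → ℝ} {x g : F} {L m : ℝ} (hL : 0 < L) (hm : 0 < m)
    (hLm : L * m < 2) (hf : ∀ u, f (x + u) ≤ f x + inner ℝ g u + L / 2 * ‖u‖ ^ 2) {v : ι → F}
    (hv : Orthonormal ℝ v) (w : ι → ℝ) :
    f (x - m • ∑ i, w i • v i) ≤ f x - m * ((1 - L * m / 2) / 2) * projSq v g +
      m * (1 / (2 * (1 - L * m / 2)) + 1) * ∑ i, (w i - inner ℝ g (v i)) ^ 2 := by
  have hstep := hf (-(m • ∑ i, w i • v i))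
  rw [← sub_eq_add_neg, norm_neg, norm_smul, mul_pow, norm_sum_smul_sq_of_orthonormal hv,
    inner_neg_right, inner_smul_right, inner_sum, Real.norm_eq_abs, sq_abs] at hstep
  simp only [inner_smul_right] at hstep
  have hsum := Finset.sum_le_sum fun i (_ : i ∈ Finset.univ) =>
    neg_mul_add_mul_sq_le (A := L * m / 2) (by positivity) (by linarith) (inner ℝ g (v i)) (w i)
  simp only [Finset.sum_add_distrib, Finset.sum_neg_distrib, ← Finset.mul_sum,
    mul_comm (inner ℝ g _)] at hsum
  rw [projSq]
  linear_combination hstep + m * hsum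

theorem norm_smul_sum_sq_le {v : ι → F} (hv : Orthonormal ℝ v) (m : ℝ) (g : F) (w : ι → ℝ) :
    ‖m • ∑ i, w i • v i‖ ^ 2 ≤
      2 * m ^ 2 * (projSq v g + ∑ i, (w i - inner ℝ g (v i)) ^ 2) := by
  have hw : ∑ i, w i ^ 2 ≤ 2 * (projSq v g + ∑ i, (w i - inner ℝ g (v i)) ^ 2) := by
    rw [projSq, ← Finset.sum_add_distrib, Finset.mul_sum]
    gcongr with i
    simpa only [add_sub_cancel] using add_sq_le (a := inner ℝ g (v i)) (b := w i - inner ℝ g (v i))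
  calc ‖m • ∑ i, w i • v i‖ ^ 2 = m ^ 2 * ∑ i, w i ^ 2 := by
        rw [norm_smul, mul_pow, norm_sum_smul_sq_of_orthonormal hv, Real.norm_eq_abs, sq_abs]
    _ ≤ m ^ 2 * (2 * (projSq v g + ∑ i, (w i - inner ℝ g (v i)) ^ 2)) := by gcongr
    _ = 2 * m ^ 2 * (projSq v g + ∑ i, (w i - inner ℝ g (v i)) ^ 2) := by ring

end ProjectedStep

/-- The constants of a Lyapunov analysis: `a` is the guaranteed decrease of the energy
`f (x t) + H / 4 ^ t` per unit of progress, and `D` bounds the squared step length per unit of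
progress. -/
structure DescentConstants where
  a : ℝ
  H : ℝ
  D : ℝ
  a_pos : 0 < a
  H_pos : 0 < H
  D_pos : 0 < D

/-- The Lyapunov function of a trajectory `x`. The term `H / 4 ^ t` absorbs the finite difference
errors of all later steps. -/
noncomputable def energy {F : Type*} (c : DescentConstants) (f : F → ℝ) (x : ℕ → F) (t : ℕ) : ℝ :=
  f (x t) + c.H * (1 / 4) ^ t

section Step

variable {n k : ℕ} {f : EuclideanSpace ℝ (Fin n) → ℝ} {L : ℝ}

theorem gradEst_eq_smul_sum_centralDifference (f : EuclideanSpace ℝ (Fin n) → ℝ) (δ : ℝ)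
    (v : Fin k → EuclideanSpace ℝ (Fin n)) (x : EuclideanSpace ℝ (Fin n)) :
    gradEst f δ v x = ((n : ℝ) / k) • ∑ i, centralDifference f δ x (v i) • v i := by
  simp only [gradEst, centralDifference, Finset.smul_sum, smul_smul]
  refine Finset.sum_congr rfl fun i _ => ?_
  congr 1
  ring

theorem IsLSmooth.sum_centralDifference_sub_inner_sq_le (hf : IsLSmooth f L) {δ : ℝ}
    (hδ : 0 < δ) {v : Fin k → EuclideanSpace ℝ (Fin n)} (hv : Orthonormal ℝ v)
    (x : EuclideanSpace ℝ (Fin n)) :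
    ∑ i, (centralDifference f δ x (v i) - inner ℝ (gradient f x) (v i)) ^ 2 ≤
      k * (L / 2) ^ 2 * δ ^ 2 := by
  calc ∑ i, (centralDifference f δ x (v i) - inner ℝ (gradient f x) (v i)) ^ 2
      ≤ ∑ _i : Fin k, (L / 2 * δ) ^ 2 := by
        refine Finset.sum_le_sum fun i _ => sq_le_sq' ?_ ?_ <;>
          have h := abs_le.1 (hf.abs_centralDifference_sub_inner_le hδ x (v i)) <;>
          rw [hv.1 i, one_pow, mul_one] at h
        exacts [h.1, h.2]
    _ = k * (L / 2) ^ 2 * δ ^ 2 := by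
        rw [Finset.sum_const, Finset.card_univ, Fintype.card_fin, nsmul_eq_mul]
        ring

theorem IsLSmooth.exists_gradEst_step_le (hk : 0 < k) (hkn : k ≤ n) (hL : 0 < L)
    (hf : IsLSmooth f L) {η : ℝ} (hη : η ∈ Set.Ioo (0 : ℝ) (2 * k / (L * n))) :
    ∃ a b D : ℝ, 0 < a ∧ 0 < b ∧ 0 < D ∧ ∀ (x : EuclideanSpace ℝ (Fin n)) (δ : ℝ)
      (v : Fin k → EuclideanSpace ℝ (Fin n)), 0 < δ → Orthonormal ℝ v →
      f (x - η • gradEst f δ v x) ≤ f x - a * projSq v (gradient f x) + b * δ ^ 2 ∧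
      ‖η • gradEst f δ v x‖ ^ 2 ≤ D * (projSq v (gradient f x) + δ ^ 2) := by
  have hk' : (0 : ℝ) < k := by exact_mod_cast hk
  have hn' : (0 : ℝ) < n := by exact_mod_cast hk.trans_le hkn
  obtain ⟨hη₀, hη₁⟩ := hη
  obtain ⟨m, hm⟩ : ∃ m, m = η * (n / k) := ⟨_, rfl⟩
  have hm₀ : 0 < m := by rw [hm]; positivity
  have hLm : L * m < 2 := by
    rw [lt_div_iff₀ (by positivity)] at hη₁
    rw [hm, ← mul_div_assoc, ← mul_div_assoc, div_lt_iff₀ hk']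
    linarith
  have hA : 0 < 1 - L * m / 2 := by linarith
  set b : ℝ := m * (1 / (2 * (1 - L * m / 2)) + 1)
  set S : ℝ := k * (L / 2) ^ 2
  have : 0 < b := by positivity
  have : 0 < S := by positivity
  refine ⟨m * ((1 - L * m / 2) / 2), b * S, 2 * m ^ 2 * (1 + S), by positivity, by positivity,
    by positivity, fun x δ v hδ hv => ?_⟩
  have hstep : η • gradEst f δ v x = m • ∑ i, centralDifference f δ x (v i) • v i := by
    rw [gradEst_eq_smul_sum_centralDifference, smul_smul, hm]
  have herr := hf.sum_centralDifference_sub_inner_sq_le hδ hv x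
  have hproj := projSq_nonneg v (gradient f x)
  rw [hstep]
  constructor
  · linear_combination apply_sub_smul_sum_le hL hm₀ hLm (hf.apply_add_le x) hv
      (fun i => centralDifference f δ x (v i)) + b * herr
  · calc _ ≤ _ := norm_smul_sum_sq_le hv m (gradient f x) _
      _ ≤ 2 * m ^ 2 * (projSq v (gradient f x) + S * δ ^ 2) := by gcongr
      _ ≤ 2 * m ^ 2 * ((1 + S) * (projSq v (gradient f x) + δ ^ 2)) := by
        gcongr
        linear_combination S * hproj + sq_nonneg δ
      _ = _ := by ring

theorem IsLSmooth.exists_descentConstants_szgd (hk : 0 < k) (hkn : k ≤ n) (hL : 0 < L)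
    (hf : IsLSmooth f L) {η δ₀ : ℝ} (hη : η ∈ Set.Ioo (0 : ℝ) (2 * k / (L * n)))
    (hδ₀ : 0 < δ₀) :
    ∃ c : DescentConstants, ∀ (x₀ : EuclideanSpace ℝ (Fin n))
      (v : ℕ → Fin k → EuclideanSpace ℝ (Fin n)) (t : ℕ), Orthonormal ℝ (v t) →
      energy c f (szgd f η δ₀ x₀ v) (t + 1) +
          c.a * (projSq (v t) (gradient f (szgd f η δ₀ x₀ v t)) + (1 / 4) ^ t) ≤
        energy c f (szgd f η δ₀ x₀ v) t ∧
      dist (szgd f η δ₀ x₀ v t) (szgd f η δ₀ x₀ v (t + 1)) ^ 2 ≤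
        c.D * (projSq (v t) (gradient f (szgd f η δ₀ x₀ v t)) + (1 / 4) ^ t) := by
  obtain ⟨a, b, D, ha, hb, hD, hstep⟩ := hf.exists_gradEst_step_le hk hkn hL hη
  refine ⟨⟨a, 4 / 3 * (b * δ₀ ^ 2 + a), D * (1 + δ₀ ^ 2), ha, by positivity, by positivity⟩,
    fun x₀ v t hv => ?_⟩
  obtain ⟨hdesc, hnorm⟩ := hstep (szgd f η δ₀ x₀ v t) (δ₀ / 2 ^ t) (v t) (by positivity) hv
  have hδ : (δ₀ / 2 ^ t) ^ 2 = δ₀ ^ 2 * (1 / 4) ^ t := by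
    rw [div_pow, ← pow_mul, mul_comm t, pow_mul, one_div_pow]
    norm_num
    ring
  have hproj := projSq_nonneg (v t) (gradient f (szgd f η δ₀ x₀ v t))
  have hquarter : (0 : ℝ) < (1 / 4) ^ t := by positivity
  rw [hδ] at hdesc hnorm
  constructor
  · simp only [energy, pow_succ, szgd]
    linear_combination hdesc
  · rw [dist_eq_norm, szgd, sub_sub_cancel]
    linear_combination hnorm + D * (δ₀ ^ 2 * hproj + hquarter)

end Step

section Recursion

variable {E R : ℕ → ℝ} {c ρ : ℝ}

theorem eventually_half_mul_le_sum_sub (hρ : 0 < ρ)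
    (hR : Tendsto (fun t : ℕ => (∑ s ∈ Finset.range t, R s) / (t : ℝ)) atTop (𝓝 ρ)) (b : ℝ) :
    ∀ᶠ t : ℕ in atTop, ρ / 2 * t ≤ ∑ s ∈ Finset.range t, R s - b := by
  have hlim := hR.sub (tendsto_const_div_atTop_nhds_zero_nat b)
  simp only [← sub_div, sub_zero] at hlim
  filter_upwards [hlim.eventually_const_lt (half_lt_self hρ), eventually_gt_atTop 0] with t ht ht₀
  exact ((lt_div_iff₀ (by exact_mod_cast ht₀)).1 ht).le

theorem isBigO_exp_of_succ_le (hc : 0 < c) (hρ : 0 < ρ) (hE : ∀ t, 0 ≤ E t)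
    (hrec : ∀ᶠ t in atTop, E (t + 1) ≤ E t - c * R t * E t)
    (hR : Tendsto (fun t : ℕ => (∑ s ∈ Finset.range t, R s) / (t : ℝ)) atTop (𝓝 ρ)) :
    E =O[atTop] fun t : ℕ => Real.exp (-(c * (ρ / 2 * t))) := by
  obtain ⟨N, hN⟩ := eventually_atTop.1 hrec
  set S : ℕ → ℝ := fun t => ∑ s ∈ Finset.range t, R s
  have hdecay : ∀ t, N ≤ t → E t ≤ Real.exp (-(c * (S t - S N))) * E N := by
    intro t ht
    induction t, ht using Nat.le_induction with
    | base => simp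
    | succ t ht ih =>
      calc E (t + 1) ≤ (-(c * R t) + 1) * E t := by linarith [hN t ht]
        _ ≤ Real.exp (-(c * R t)) * (Real.exp (-(c * (S t - S N))) * E N) :=
            mul_le_mul (Real.add_one_le_exp _) ih (hE t) (Real.exp_pos _).le
        _ = Real.exp (-(c * (S (t + 1) - S N))) * E N := by
            rw [← mul_assoc, ← Real.exp_add]
            simp only [S, Finset.sum_range_succ]
            ring_nf
  refine IsBigO.of_bound (E N) ?_
  filter_upwards [eventually_ge_atTop N, eventually_half_mul_le_sum_sub hρ hR (S N)] with t ht hS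
  rw [Real.norm_of_nonneg (hE t), Real.norm_of_nonneg (Real.exp_pos _).le, mul_comm]
  refine (hdecay t ht).trans (mul_le_mul_of_nonneg_right ?_ (hE N))
  gcongr

-- Convexity of `x ↦ x ^ (-γ)`: the decrement of `x` turns into an increment of `x ^ (-γ)`.
theorem rpow_neg_add_le_rpow_neg {x y b γ : ℝ} (hy : 0 < y) (hyx : y ≤ x) (hγ : 0 < γ)
    (h : y ≤ x - b * x ^ (γ + 1)) : x ^ (-γ) + γ * b ≤ y ^ (-γ) := by
  have hx : 0 < x := hy.trans_le hyx
  have hyx₀ : 0 < y / x := div_pos hy hx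
  have hratio : 1 + γ * (1 - y / x) ≤ (y / x) ^ (-γ) := by
    have hlog := Real.log_le_sub_one_of_pos hyx₀
    calc 1 + γ * (1 - y / x) ≤ Real.log (y / x) * -γ + 1 := by
          linear_combination γ * hlog
      _ ≤ (y / x) ^ (-γ) := by
          rw [Real.rpow_def_of_pos hyx₀]
          exact Real.add_one_le_exp _
  have hb : x ^ γ * b ≤ 1 - y / x := by
    rw [Real.rpow_add_one hx.ne'] at h
    rw [le_sub_iff_add_le, ← le_sub_iff_add_le', div_le_iff₀ hx]
    linarith
  calc x ^ (-γ) + γ * b = x ^ (-γ) * (1 + γ * (x ^ γ * b)) := by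
        rw [Real.rpow_neg hx.le]
        field_simp
    _ ≤ x ^ (-γ) * (y / x) ^ (-γ) := by
        gcongr
        refine le_trans ?_ hratio
        gcongr
    _ = y ^ (-γ) := by rw [← Real.mul_rpow hx.le hyx₀.le, mul_div_cancel₀ _ hx.ne']

theorem isBigO_rpow_of_succ_le {γ : ℝ} (hc : 0 < c) (hρ : 0 < ρ) (hγ : 0 < γ) (hE : ∀ t, 0 < E t)
    (hanti : Antitone E) (hrec : ∀ᶠ t in atTop, E (t + 1) ≤ E t - c * R t * E t ^ (γ + 1))
    (hR : Tendsto (fun t : ℕ => (∑ s ∈ Finset.range t, R s) / (t : ℝ)) atTop (𝓝 ρ)) :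
    E =O[atTop] fun t : ℕ => (t : ℝ) ^ (-(1 / γ)) := by
  obtain ⟨N, hN⟩ := eventually_atTop.1 hrec
  set S : ℕ → ℝ := fun t => ∑ s ∈ Finset.range t, R s
  have hgrowth : ∀ t, N ≤ t → γ * c * (S t - S N) ≤ E t ^ (-γ) := by
    intro t ht
    induction t, ht using Nat.le_induction with
    | base => simpa using Real.rpow_nonneg (hE N).le _
    | succ t ht ih =>
      have hstep := rpow_neg_add_le_rpow_neg (hE (t + 1)) (hanti t.le_succ) hγ (hN t ht)
      simp only [S, Finset.sum_range_succ] at ih ⊢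
      linarith
  have hm : 0 < γ * c * (ρ / 2) := by positivity
  refine IsBigO.of_bound ((γ * c * (ρ / 2)) ^ (-(1 / γ))) ?_
  filter_upwards [eventually_ge_atTop N, eventually_half_mul_le_sum_sub hρ hR (S N),
    eventually_gt_atTop 0] with t ht hS ht₀
  have ht₀' : (0 : ℝ) < t := by exact_mod_cast ht₀
  have hlower : γ * c * (ρ / 2) * t ≤ E t ^ (-γ) := by
    refine le_trans ?_ (hgrowth t ht)
    rw [mul_assoc (γ * c)]
    gcongr
  rw [Real.norm_of_nonneg (hE t).le, Real.norm_of_nonneg (by positivity),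
    ← Real.mul_rpow hm.le ht₀'.le]
  calc E t = (E t ^ (-γ)) ^ (-(1 / γ)) := by
        rw [← Real.rpow_mul (hE t).le, neg_mul_neg, mul_one_div_cancel hγ.ne', Real.rpow_one]
    _ ≤ (γ * c * (ρ / 2) * t) ^ (-(1 / γ)) :=
        Real.rpow_le_rpow_of_nonpos (by positivity) hlower (by rw [neg_nonpos]; positivity)

end Recursion

section SquaredSteps

variable {X : Type*} [PseudoMetricSpace X] {x : ℕ → X} {E : ℕ → ℝ} {p : X}

theorem isBigO_dist_succ_of_isBigO_sq {D : ℝ} {g : ℕ → ℝ} (hD : 0 ≤ D) (hE : ∀ t, 0 ≤ E t)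
    (hstep : ∀ t, dist (x t) (x (t + 1)) ^ 2 ≤ D * (E t - E (t + 1)))
    (hO : E =O[atTop] fun t => g t ^ 2) :
    (fun t => dist (x t) (x (t + 1))) =O[atTop] g := by
  refine IsBigO.of_pow two_ne_zero (IsBigO.trans (IsBigO.of_bound D ?_) hO)
  refine Eventually.of_forall fun t => ?_
  simp only [Pi.pow_apply]
  rw [Real.norm_of_nonneg (sq_nonneg _), Real.norm_of_nonneg (hE t)]
  exact (hstep t).trans (by gcongr; linarith [hE (t + 1)])

theorem exists_dist_succ_le_geometric {r : ℝ} (hr : 0 < r)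
    (hO : (fun t => dist (x t) (x (t + 1))) =O[atTop] fun t : ℕ => r ^ t) :
    ∃ C : ℝ, ∀ t, dist (x t) (x (t + 1)) ≤ C * r ^ t := by
  obtain ⟨C, hC⟩ := (isBigO_nat_atTop_iff fun t ht => absurd ht (pow_pos hr t).ne').1 hO
  refine ⟨C, fun t => ?_⟩
  simpa only [Real.norm_of_nonneg dist_nonneg, Real.norm_of_nonneg (pow_pos hr t).le] using hC t

theorem tendsto_pow_mul_dist {r C Q : ℝ} (hr₀ : 0 < r) (hr₁ : r < 1) (hQ : 0 ≤ Q)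
    (hQr : Q * r < 1) (hstep : ∀ t, dist (x t) (x (t + 1)) ≤ C * r ^ t)
    (hp : Tendsto x atTop (𝓝 p)) : Tendsto (fun t : ℕ => Q ^ t * dist (x t) p) atTop (𝓝 0) := by
  have hgeom : Tendsto (fun t : ℕ => C / (1 - r) * (Q * r) ^ t) atTop (𝓝 0) := by
    simpa only [mul_zero] using
      (tendsto_pow_atTop_nhds_zero_of_lt_one (by positivity) hQr).const_mul (C / (1 - r))
  refine squeeze_zero (fun t => by positivity) (fun t => ?_) hgeom
  calc Q ^ t * dist (x t) p ≤ Q ^ t * (C * r ^ t / (1 - r)) := by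
        gcongr
        exact dist_le_of_le_geometric_of_tendsto r C hr₁ hstep hp t
    _ = C / (1 - r) * (Q * r) ^ t := by rw [mul_pow]; ring

theorem dist_sq_le_mul_sub {D : ℝ}
    (hstep : ∀ t, dist (x t) (x (t + 1)) ^ 2 ≤ D * (E t - E (t + 1)))
    {m s : ℕ} (hms : m ≤ s) : dist (x m) (x s) ^ 2 ≤ (s - m : ℕ) * (D * (E m - E s)) := by
  calc dist (x m) (x s) ^ 2 ≤ (∑ i ∈ Finset.Ico m s, dist (x i) (x (i + 1))) ^ 2 := by
        gcongr
        exact dist_le_Ico_sum_dist x hms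
    _ ≤ (Finset.Ico m s).card * ∑ i ∈ Finset.Ico m s, dist (x i) (x (i + 1)) ^ 2 :=
        sq_sum_le_card_mul_sum_sq
    _ ≤ (s - m : ℕ) * ∑ i ∈ Finset.Ico m s, D * (E i - E (i + 1)) := by
        rw [Nat.card_Ico]
        gcongr with i _
        exact hstep i
    _ = (s - m : ℕ) * (D * (E m - E s)) := by
        rw [← Finset.mul_sum, ← neg_sub (E s), ← Finset.sum_Ico_sub E hms, ← Finset.sum_neg_distrib]
        simp only [neg_sub]

theorem exists_dist_le_rpow_of_le_two_mul {D α : ℝ} (hD : 0 ≤ D) (hE : ∀ t, 0 ≤ E t)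
    (hstep : ∀ t, dist (x t) (x (t + 1)) ^ 2 ≤ D * (E t - E (t + 1)))
    (hO : E =O[atTop] fun t : ℕ => (t : ℝ) ^ (-(2 * α + 1))) :
    ∃ B : ℝ, 0 ≤ B ∧ ∀ᶠ t : ℕ in atTop, ∀ s, t ≤ s → s ≤ 2 * t →
      dist (x t) (x s) ≤ B * (t : ℝ) ^ (-α) := by
  obtain ⟨M, hM, hEM⟩ := hO.exists_pos
  refine ⟨√(D * M), Real.sqrt_nonneg _, ?_⟩
  filter_upwards [hEM.bound, eventually_gt_atTop 0] with t ht ht₀ s hts hs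
  have ht₀' : (0 : ℝ) < t := by exact_mod_cast ht₀
  rw [Real.norm_of_nonneg (hE t), Real.norm_of_nonneg (by positivity)] at ht
  refine le_of_sq_le_sq ?_ (by positivity)
  calc dist (x t) (x s) ^ 2 ≤ (s - t : ℕ) * (D * (E t - E s)) := dist_sq_le_mul_sub hstep hts
    _ ≤ (s - t : ℕ) * (D * (M * (t : ℝ) ^ (-(2 * α + 1)))) := by
        gcongr
        linarith [hE s]
    _ ≤ t * (D * (M * (t : ℝ) ^ (-(2 * α + 1)))) := by
        gcongr
        omega
    _ = D * M * (t : ℝ) ^ (-(2 * α)) := by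
        rw [neg_add, Real.rpow_add ht₀', Real.rpow_neg_one]
        field_simp
    _ = (√(D * M) * (t : ℝ) ^ (-α)) ^ 2 := by
        rw [mul_pow, Real.sq_sqrt (by positivity), ← Real.rpow_natCast, ← Real.rpow_mul ht₀'.le]
        norm_num [mul_comm]

-- Summing the estimates over the dyadic blocks `[2 ^ j * t, 2 ^ (j + 1) * t]` gives a geometric
-- series with ratio `2 ^ (-α)`.
theorem dist_le_rpow_of_dist_le_rpow_of_le_two_mul {B α : ℝ} (hα : 0 < α) (hB : 0 ≤ B)
    (hshort : ∀ᶠ t : ℕ in atTop, ∀ s, t ≤ s → s ≤ 2 * t → dist (x t) (x s) ≤ B * (t : ℝ) ^ (-α)) :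
    ∀ᶠ t : ℕ in atTop, ∀ s, t ≤ s → dist (x t) (x s) ≤ B / (1 - 2 ^ (-α)) * (t : ℝ) ^ (-α) := by
  set r : ℝ := 2 ^ (-α)
  have hr₀ : 0 < r := by positivity
  have hr₁ : 0 < 1 - r := sub_pos.2 (Real.rpow_lt_one_of_one_lt_of_neg one_lt_two (by linarith))
  obtain ⟨N, hN⟩ := eventually_atTop.1 (hshort.and (eventually_gt_atTop 0))
  have hlong : ∀ d t, N ≤ t → dist (x t) (x (t + d)) ≤ B / (1 - r) * (t : ℝ) ^ (-α) := by
    intro d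
    induction d using Nat.strong_induction_on with
    | _ d ih =>
      intro t ht
      obtain ⟨hblock, ht₀⟩ := hN t ht
      rcases le_or_gt d t with hd | hd
      · refine (hblock (t + d) (by omega) (by omega)).trans ?_
        gcongr
        exact le_div_self hB hr₁ (by linarith)
      · have hrest := ih (d - t) (by omega) (2 * t) (by omega)
        rw [show 2 * t + (d - t) = t + d by omega, Nat.cast_mul, Nat.cast_ofNat,
          Real.mul_rpow zero_le_two (Nat.cast_nonneg t)] at hrest
        calc dist (x t) (x (t + d)) ≤ dist (x t) (x (2 * t)) + dist (x (2 * t)) (x (t + d)) :=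
              dist_triangle _ _ _
          _ ≤ B * (t : ℝ) ^ (-α) + B / (1 - r) * (r * (t : ℝ) ^ (-α)) :=
              add_le_add (hblock (2 * t) (by omega) le_rfl) hrest
          _ = B / (1 - r) * (t : ℝ) ^ (-α) := by
              field_simp
              ring
  filter_upwards [eventually_ge_atTop N] with t ht s hts
  simpa only [Nat.add_sub_cancel' hts] using hlong (s - t) t ht

theorem cauchySeq_of_dist_le_rpow {C α : ℝ} (hα : 0 < α)
    (h : ∀ᶠ t : ℕ in atTop, ∀ s, t ≤ s → dist (x t) (x s) ≤ C * (t : ℝ) ^ (-α)) :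
    CauchySeq x := by
  have hlim : Tendsto (fun t : ℕ => C * (t : ℝ) ^ (-α)) atTop (𝓝 0) := by
    simpa using ((tendsto_rpow_neg_atTop hα).comp tendsto_natCast_atTop_atTop).const_mul C
  refine Metric.cauchySeq_iff'.2 fun ε hε => ?_
  obtain ⟨N, hN, hNε⟩ := (h.and (hlim.eventually_lt_const hε)).exists
  exact ⟨N, fun s hs => (dist_comm _ _).trans_lt ((hN s hs).trans_lt hNε)⟩

theorem isBigO_dist_of_dist_le_rpow {C α : ℝ}
    (h : ∀ᶠ t : ℕ in atTop, ∀ s, t ≤ s → dist (x t) (x s) ≤ C * (t : ℝ) ^ (-α))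
    (hp : Tendsto x atTop (𝓝 p)) :
    (fun t => dist (x t) p) =O[atTop] fun t : ℕ => (t : ℝ) ^ (-α) := by
  refine IsBigO.of_bound C ?_
  filter_upwards [h] with t ht
  rw [Real.norm_of_nonneg dist_nonneg, Real.norm_of_nonneg (by positivity)]
  exact le_of_tendsto (tendsto_const_nhds.dist hp) ((eventually_ge_atTop t).mono ht)

end SquaredSteps

/-- The rate `r` in the recursion `E (t + 1) ≤ E t - r * R t * E t ^ (2 * θ)` that the gap `E` of
the energy to its limit satisfies under a Łojasiewicz inequality with constant `K`. -/
noncomputable def gapRate (c : DescentConstants) (θ K : ℝ) : ℝ :=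
  c.a / (2 ^ (2 * θ - 1) * (K ^ 2 + c.H ^ (2 * θ)))

/-- A linear convergence rate of trajectories with average progress ratio `ρ` under a Łojasiewicz
inequality with exponent `1 / 2` and constant `K`: half of what the decay of the energy gives, so
that the products with the distances to the limit tend to zero. -/
noncomputable def linearRate (c : DescentConstants) (ρ K : ℝ) : ℝ :=
  Real.exp (gapRate c (1 / 2) K * ρ / 8)

theorem gapRate_pos (c : DescentConstants) (θ K : ℝ) : 0 < gapRate c θ K := by
  have := c.a_pos
  have := c.H_pos
  rw [gapRate]
  positivity

theorem one_lt_linearRate (c : DescentConstants) {ρ : ℝ} (hρ : 0 < ρ) (K : ℝ) :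
    1 < linearRate c ρ K := by
  have := gapRate_pos c (1 / 2) K
  exact Real.one_lt_exp_iff.2 (by positivity)

theorem add_rpow_le_two_rpow_mul {u w β : ℝ} (hu : 0 ≤ u) (hw : 0 ≤ w) (hβ : 1 ≤ β) :
    (u + w) ^ β ≤ 2 ^ (β - 1) * (u ^ β + w ^ β) := by
  lift u to NNReal using hu
  lift w to NNReal using hw
  exact_mod_cast NNReal.rpow_add_le_mul_rpow_add_rpow u w hβ

theorem add_rpow_two_mul_le_of_abs_rpow_le {y h q G K θ : ℝ} (hθ : 1 / 2 ≤ θ) (hh : 0 < h)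
    (hq₀ : 0 < q) (hq₁ : q ≤ 1) (hy : 0 ≤ y + h * q) (hyG : |y| ^ θ ≤ K * G) :
    (y + h * q) ^ (2 * θ) ≤ 2 ^ (2 * θ - 1) * (K ^ 2 + h ^ (2 * θ)) * (G ^ 2 + q) := by
  have hgap : |y| ^ (2 * θ) ≤ K ^ 2 * G ^ 2 := by
    rw [mul_comm 2 θ, Real.rpow_mul (abs_nonneg _), ← mul_pow, Real.rpow_two]
    gcongr
  have hres : (h * q) ^ (2 * θ) ≤ h ^ (2 * θ) * q := by
    rw [Real.mul_rpow hh.le hq₀.le]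
    gcongr
    exact Real.rpow_le_self_of_le_one hq₀.le hq₁ (by linarith)
  calc (y + h * q) ^ (2 * θ) ≤ (|y| + h * q) ^ (2 * θ) := by
        gcongr
        exact le_abs_self y
    _ ≤ 2 ^ (2 * θ - 1) * (|y| ^ (2 * θ) + (h * q) ^ (2 * θ)) :=
        add_rpow_le_two_rpow_mul (abs_nonneg _) (by positivity) (by linarith)
    _ ≤ 2 ^ (2 * θ - 1) * (K ^ 2 * G ^ 2 + h ^ (2 * θ) * q) := by gcongr
    _ ≤ 2 ^ (2 * θ - 1) * (K ^ 2 + h ^ (2 * θ)) * (G ^ 2 + q) := by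
        rw [mul_assoc]
        gcongr
        linear_combination (by positivity : 0 ≤ K ^ 2 * q + h ^ (2 * θ) * G ^ 2)

theorem tendsto_energy_iff {F : Type*} (c : DescentConstants) {f : F → ℝ} {x : ℕ → F} {l : ℝ} :
    Tendsto (energy c f x) atTop (𝓝 l) ↔ Tendsto (fun t => f (x t)) atTop (𝓝 l) := by
  have hres : Tendsto (fun t : ℕ => c.H * (1 / 4 : ℝ) ^ t) atTop (𝓝 0) := by
    simpa only [mul_zero] using
      (tendsto_pow_atTop_nhds_zero_of_lt_one (by norm_num : (0 : ℝ) ≤ 1 / 4)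
        (by norm_num)).const_mul c.H
  constructor <;> intro h
  · simpa only [energy, add_sub_cancel_right, sub_zero] using h.sub hres
  · exact add_zero l ▸ h.add hres

/-- A trajectory of a descent method with noisy progress: in step `t` the energy decreases in
proportion to `R t * ‖∇f (x t)‖ ^ 2 + 1 / 4 ^ t`, where `R t ∈ [0, 1]` is the part of the squared
gradient that the search directions see and `ρ` is its average over time, and the squared step
length is bounded by a multiple of the same quantity. -/
structure IsDescentPath {F : Type*} [NormedAddCommGroup F] [InnerProductSpace ℝ F]
    [CompleteSpace F] (c : DescentConstants) (ρ : ℝ) (f : F → ℝ) (R : ℕ → ℝ) (x : ℕ → F) :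
    Prop where
  mem_Icc : ∀ t, R t ∈ Set.Icc (0 : ℝ) 1
  tendsto_average :
    Tendsto (fun t : ℕ => (∑ s ∈ Finset.range t, R s) / (t : ℝ)) atTop (𝓝 ρ)
  energy_succ_add_le : ∀ t, energy c f x (t + 1) +
    c.a * (R t * ‖gradient f (x t)‖ ^ 2 + (1 / 4) ^ t) ≤ energy c f x t
  dist_sq_le : ∀ t,
    dist (x t) (x (t + 1)) ^ 2 ≤ c.D * (R t * ‖gradient f (x t)‖ ^ 2 + (1 / 4) ^ t)

namespace IsDescentPath

variable {F : Type*} [NormedAddCommGroup F] [InnerProductSpace ℝ F] [CompleteSpace F]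
  {c : DescentConstants} {ρ : ℝ} {f : F → ℝ} {R : ℕ → ℝ} {x : ℕ → F} {l K θ : ℝ} {p : F}

theorem strictAnti_energy (h : IsDescentPath c ρ f R x) : StrictAnti (energy c f x) := by
  refine strictAnti_nat_of_succ_lt fun t => ?_
  have hR := (h.mem_Icc t).1
  have ha := c.a_pos
  have hprogress : 0 < c.a * (R t * ‖gradient f (x t)‖ ^ 2 + (1 / 4) ^ t) := by positivity
  linarith [h.energy_succ_add_le t]

theorem exists_tendsto_apply (h : IsDescentPath c ρ f R x)
    (hb : BddBelow (Set.range fun t => f (x t))) :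
    ∃ l, Tendsto (fun t => f (x t)) atTop (𝓝 l) := by
  obtain ⟨m, hm⟩ := hb
  have hbdd : BddBelow (Set.range (energy c f x)) := by
    refine ⟨m, ?_⟩
    rintro _ ⟨t, rfl⟩
    have hres : 0 < c.H * (1 / 4 : ℝ) ^ t := mul_pos c.H_pos (by positivity)
    exact (hm ⟨t, rfl⟩).trans (le_add_of_nonneg_right hres.le)
  exact ⟨_, (tendsto_energy_iff c).1 (tendsto_atTop_ciInf h.strictAnti_energy.antitone hbdd)⟩

theorem energy_sub_pos (h : IsDescentPath c ρ f R x)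
    (hl : Tendsto (fun t => f (x t)) atTop (𝓝 l)) (t : ℕ) : 0 < energy c f x t - l :=
  sub_pos.2 <| (h.strictAnti_energy.antitone.le_of_tendsto ((tendsto_energy_iff c).2 hl)
    (t + 1)).trans_lt (h.strictAnti_energy t.lt_succ_self)

theorem tendsto_mul_norm_gradient_sq (h : IsDescentPath c ρ f R x)
    (hl : Tendsto (fun t => f (x t)) atTop (𝓝 l)) :
    Tendsto (fun t => R t * ‖gradient f (x t)‖ ^ 2) atTop (𝓝 0) := by
  have henergy := (tendsto_energy_iff c).2 hl
  have hdiff : Tendsto (fun t => (energy c f x t - energy c f x (t + 1)) / c.a) atTop (𝓝 0) := by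
    simpa only [sub_self, zero_div] using
      (henergy.sub ((tendsto_add_atTop_iff_nat 1).2 henergy)).div_const c.a
  refine squeeze_zero (fun t => mul_nonneg (h.mem_Icc t).1 (sq_nonneg _)) (fun t => ?_) hdiff
  rw [le_div_iff₀ c.a_pos]
  have hres : 0 < c.a * (1 / 4 : ℝ) ^ t := mul_pos c.a_pos (by positivity)
  linarith [h.energy_succ_add_le t]

theorem dist_sq_le_energy_sub (h : IsDescentPath c ρ f R x) (l : ℝ) (t : ℕ) :
    dist (x t) (x (t + 1)) ^ 2 ≤
      c.D / c.a * ((energy c f x t - l) - (energy c f x (t + 1) - l)) := by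
  have ha := c.a_pos
  have hD := c.D_pos
  calc dist (x t) (x (t + 1)) ^ 2 ≤ c.D * (R t * ‖gradient f (x t)‖ ^ 2 + (1 / 4) ^ t) :=
        h.dist_sq_le t
    _ = c.D / c.a * (c.a * (R t * ‖gradient f (x t)‖ ^ 2 + (1 / 4) ^ t)) := by field_simp
    _ ≤ c.D / c.a * ((energy c f x t - l) - (energy c f x (t + 1) - l)) := by
        gcongr
        linarith [h.energy_succ_add_le t]

theorem eventually_energy_succ_sub_le (h : IsDescentPath c ρ f R x) (hθ : 1 / 2 ≤ θ)
    (hl : Tendsto (fun t => f (x t)) atTop (𝓝 l))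
    (hloj : ∀ᶠ t in atTop, |f (x t) - l| ^ θ ≤ K * ‖gradient f (x t)‖) :
    ∀ᶠ t in atTop, energy c f x (t + 1) - l ≤
      energy c f x t - l - gapRate c θ K * R t * (energy c f x t - l) ^ (2 * θ) := by
  filter_upwards [hloj] with t ht
  have ha := c.a_pos
  have hH := c.H_pos
  have hq₀ : (0 : ℝ) < (1 / 4) ^ t := by positivity
  have hgap : f (x t) - l + c.H * (1 / 4) ^ t = energy c f x t - l := by rw [energy]; ring
  have hle := add_rpow_two_mul_le_of_abs_rpow_le hθ hH hq₀
    (pow_le_one₀ (by norm_num) (by norm_num)) (hgap ▸ (h.energy_sub_pos hl t).le) ht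
  rw [hgap] at hle
  obtain ⟨hR₀, hR₁⟩ := h.mem_Icc t
  have hprogress : gapRate c θ K * R t * (energy c f x t - l) ^ (2 * θ) ≤
      c.a * (R t * ‖gradient f (x t)‖ ^ 2 + (1 / 4) ^ t) := by
    have := gapRate_pos c θ K
    calc gapRate c θ K * R t * (energy c f x t - l) ^ (2 * θ) ≤ gapRate c θ K * R t *
          (2 ^ (2 * θ - 1) * (K ^ 2 + c.H ^ (2 * θ)) * (‖gradient f (x t)‖ ^ 2 + (1 / 4) ^ t)) := by
          gcongr
      _ = c.a * (R t * ‖gradient f (x t)‖ ^ 2 + R t * (1 / 4) ^ t) := by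
          rw [gapRate]
          field_simp
      _ ≤ c.a * (R t * ‖gradient f (x t)‖ ^ 2 + (1 / 4) ^ t) := by
          gcongr
          exact mul_le_of_le_one_left hq₀.le hR₁
  linarith [h.energy_succ_add_le t]

theorem exists_dist_succ_le_pow (h : IsDescentPath c ρ f R x) (hρ : 0 < ρ)
    (hl : Tendsto (fun t => f (x t)) atTop (𝓝 l))
    (hloj : ∀ᶠ t in atTop, |f (x t) - l| ^ (1 / 2 : ℝ) ≤ K * ‖gradient f (x t)‖) :
    ∃ C : ℝ, ∀ t, dist (x t) (x (t + 1)) ≤ C * (linearRate c ρ K ^ 2)⁻¹ ^ t := by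
  have hrec := h.eventually_energy_succ_sub_le le_rfl hl hloj
  simp only [mul_one_div_cancel (two_ne_zero' ℝ), Real.rpow_one] at hrec
  have hE := fun t => (h.energy_sub_pos hl t).le
  have hO := isBigO_exp_of_succ_le (gapRate_pos c (1 / 2) K) hρ hE hrec h.tendsto_average
  have hsq : (fun t : ℕ => Real.exp (-(gapRate c (1 / 2) K * (ρ / 2 * t)))) =
      fun t => ((linearRate c ρ K ^ 2)⁻¹ ^ t) ^ 2 := by
    ext t
    rw [linearRate, ← Real.exp_nat_mul, ← Real.exp_neg, ← Real.exp_nat_mul, ← Real.exp_nat_mul]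
    push_cast
    ring_nf
  rw [hsq] at hO
  exact exists_dist_succ_le_geometric (by have := one_lt_linearRate c hρ K; positivity)
    (isBigO_dist_succ_of_isBigO_sq (div_pos c.D_pos c.a_pos).le hE (h.dist_sq_le_energy_sub l) hO)

theorem cauchySeq_of_lojasiewicz_half (h : IsDescentPath c ρ f R x) (hρ : 0 < ρ)
    (hl : Tendsto (fun t => f (x t)) atTop (𝓝 l))
    (hloj : ∀ᶠ t in atTop, |f (x t) - l| ^ (1 / 2 : ℝ) ≤ K * ‖gradient f (x t)‖) :
    CauchySeq x := by
  obtain ⟨C, hC⟩ := h.exists_dist_succ_le_pow hρ hl hloj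
  exact cauchySeq_of_le_geometric _ C
    (inv_lt_one_of_one_lt₀ (one_lt_pow₀ (one_lt_linearRate c hρ K) two_ne_zero)) hC

theorem tendsto_linearRate_pow_mul_dist (h : IsDescentPath c ρ f R x) (hρ : 0 < ρ)
    (hl : Tendsto (fun t => f (x t)) atTop (𝓝 l))
    (hloj : ∀ᶠ t in atTop, |f (x t) - l| ^ (1 / 2 : ℝ) ≤ K * ‖gradient f (x t)‖)
    (hp : Tendsto x atTop (𝓝 p)) :
    Tendsto (fun t : ℕ => linearRate c ρ K ^ t * dist (x t) p) atTop (𝓝 0) := by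
  obtain ⟨C, hC⟩ := h.exists_dist_succ_le_pow hρ hl hloj
  have hQ := one_lt_linearRate c hρ K
  have hQ₀ := zero_lt_one.trans hQ
  refine tendsto_pow_mul_dist (by positivity)
    (inv_lt_one_of_one_lt₀ (one_lt_pow₀ hQ two_ne_zero)) hQ₀.le ?_ hC hp
  rw [sq, mul_inv, mul_inv_cancel_left₀ hQ₀.ne']
  exact inv_lt_one_of_one_lt₀ hQ

theorem exists_dist_le_rpow (h : IsDescentPath c ρ f R x) (hρ : 0 < ρ)
    (hθ : θ ∈ Set.Ioo (1 / 2 : ℝ) 1) (hl : Tendsto (fun t => f (x t)) atTop (𝓝 l))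
    (hloj : ∀ᶠ t in atTop, |f (x t) - l| ^ θ ≤ K * ‖gradient f (x t)‖) :
    ∃ C : ℝ, ∀ᶠ t : ℕ in atTop, ∀ s, t ≤ s →
      dist (x t) (x s) ≤ C * (t : ℝ) ^ (-((1 - θ) / (2 * θ - 1))) := by
  obtain ⟨hθ₀, hθ₁⟩ := hθ
  have hγ : 0 < 2 * θ - 1 := by linarith
  have hrec := h.eventually_energy_succ_sub_le hθ₀.le hl hloj
  rw [← sub_add_cancel (2 * θ) 1] at hrec
  have hanti : Antitone fun t => energy c f x t - l :=
    fun s t hst => sub_le_sub_right (h.strictAnti_energy.antitone hst) l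
  have hO := isBigO_rpow_of_succ_le (gapRate_pos c θ K) hρ hγ (h.energy_sub_pos hl) hanti hrec
    h.tendsto_average
  have hexp : -(1 / (2 * θ - 1)) = -(2 * ((1 - θ) / (2 * θ - 1)) + 1) := by
    field_simp
    ring
  rw [hexp] at hO
  obtain ⟨B, hB, hshort⟩ := exists_dist_le_rpow_of_le_two_mul (div_pos c.D_pos c.a_pos).le
    (fun t => (h.energy_sub_pos hl t).le) (h.dist_sq_le_energy_sub l) hO
  exact ⟨_, dist_le_rpow_of_dist_le_rpow_of_le_two_mul (div_pos (by linarith) hγ) hB hshort⟩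

theorem isBigO_dist (h : IsDescentPath c ρ f R x) (hρ : 0 < ρ)
    (hθ : θ ∈ Set.Ioo (1 / 2 : ℝ) 1) (hl : Tendsto (fun t => f (x t)) atTop (𝓝 l))
    (hloj : ∀ᶠ t in atTop, |f (x t) - l| ^ θ ≤ K * ‖gradient f (x t)‖)
    (hp : Tendsto x atTop (𝓝 p)) :
    (fun t => dist (x t) p) =O[atTop] fun t : ℕ => (t : ℝ) ^ ((1 - θ) / (1 - 2 * θ)) := by
  obtain ⟨C, hC⟩ := h.exists_dist_le_rpow hρ hθ hl hloj
  have hexp : (1 - θ) / (1 - 2 * θ) = -((1 - θ) / (2 * θ - 1)) := by rw [← div_neg, neg_sub]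
  rw [hexp]
  exact isBigO_dist_of_dist_le_rpow hC hp

end IsDescentPath

section Lojasiewicz

variable {n : ℕ} {f : EuclideanSpace ℝ (Fin n) → ℝ} {θ θ' κ l : ℝ}
  {x : ℕ → EuclideanSpace ℝ (Fin n)} {p : EuclideanSpace ℝ (Fin n)}

theorem lojasiewiczAt_iff_eventually :
    LojasiewiczAt f θ κ p ↔ ∀ᶠ y in 𝓝 p, |f y - f p| ^ θ ≤ κ * ‖gradient f y‖ := by
  simp only [LojasiewiczAt, Metric.nhds_basis_closedBall.eventually_iff, mem_closedBall_iff_norm]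

theorem LojasiewiczAt.eventually_of_tendsto (h : LojasiewiczAt f θ κ p) (hf : ContinuousAt f p)
    (hp : Tendsto x atTop (𝓝 p)) (hl : Tendsto (fun t => f (x t)) atTop (𝓝 l)) :
    ∀ᶠ t in atTop, |f (x t) - l| ^ θ ≤ κ * ‖gradient f (x t)‖ := by
  rw [tendsto_nhds_unique hl (hf.tendsto.comp hp)]
  exact hp.eventually (lojasiewiczAt_iff_eventually.1 h)

theorem LojasiewiczAt.mono (h : LojasiewiczAt f θ κ p) (hf : ContinuousAt f p) (hθ : 0 ≤ θ)
    (hle : θ ≤ θ') : LojasiewiczAt f θ' κ p := by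
  rw [lojasiewiczAt_iff_eventually] at h ⊢
  filter_upwards [h, Metric.continuousAt_iff'.1 hf 1 one_pos] with y hy hclose
  exact (Real.rpow_le_rpow_of_exponent_ge' (abs_nonneg _) hclose.le hθ hle).trans hy

theorem IsLojasiewiczWith.mono (h : IsLojasiewiczWith f θ κ) (hθ : 0 ≤ θ) (hle : θ ≤ θ') :
    IsLojasiewiczWith f θ' κ :=
  ⟨h.1, fun p hp => (h.2 p hp).mono (h.1 p).continuousAt hθ hle⟩

theorem IsLojasiewicz.mono (h : IsLojasiewicz f θ) (hθ : 0 ≤ θ) (hle : θ ≤ θ') :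
    IsLojasiewicz f θ' :=
  ⟨h.1, fun p hp => (h.2 p hp).imp fun _ hκ =>
    ⟨hκ.1, hκ.2.mono (h.1 p).continuousAt hθ hle⟩⟩

theorem exists_lojasiewiczAt_of_gradient_ne_zero (hf : ContinuousAt f p)
    (hf' : ContinuousAt (gradient f) p) (hθ : 0 ≤ θ) (hp : gradient f p ≠ 0) :
    ∃ κ, LojasiewiczAt f θ κ p := by
  have hgap : Tendsto (fun y => |f y - f p| ^ θ) (𝓝 p) (𝓝 (|f p - f p| ^ θ)) :=
    (hf.tendsto.sub_const _).abs.rpow_const (Or.inr hθ)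
  have hnorm := hf'.norm.tendsto.const_mul ((|f p - f p| ^ θ + 1) / ‖gradient f p‖)
  rw [div_mul_cancel₀ _ (norm_ne_zero_iff.2 hp)] at hnorm
  exact ⟨_, lojasiewiczAt_iff_eventually.2 <|
    (hgap.eventually_lt hnorm (lt_add_one _)).mono fun _ => le_of_lt⟩

theorem IsLojasiewicz.exists_lojasiewiczAt (h : IsLojasiewicz f θ)
    (hf' : Continuous (gradient f)) (hθ : 0 ≤ θ) (p : EuclideanSpace ℝ (Fin n)) :
    ∃ κ, LojasiewiczAt f θ κ p := by
  by_cases hp : gradient f p = 0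
  · exact (h.2 p hp).imp fun _ hκ => hκ.2
  · exact exists_lojasiewiczAt_of_gradient_ne_zero (h.1 p).continuousAt hf'.continuousAt hθ hp

theorem IsLojasiewicz.exists_eventually_of_isBounded (h : IsLojasiewicz f θ)
    (hf' : Continuous (gradient f)) (hθ : 0 ≤ θ) (hx : Bornology.IsBounded (Set.range x))
    (hl : Tendsto (fun t => f (x t)) atTop (𝓝 l)) :
    ∃ K, ∀ᶠ t in atTop, |f (x t) - l| ^ θ ≤ K * ‖gradient f (x t)‖ := by
  by_contra! hfreq
  obtain ⟨φ, hφ, hbad⟩ := extraction_forall_of_frequently fun N : ℕ => hfreq N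
  obtain ⟨p, -, ψ, hψ, hp⟩ := tendsto_subseq_of_bounded hx fun N => Set.mem_range_self (φ N)
  obtain ⟨κ, hκ⟩ := h.exists_lojasiewiczAt hf' hθ p
  have hgood := hκ.eventually_of_tendsto (h.1 p).continuousAt hp
    (hl.comp (hφ.tendsto_atTop.comp hψ.tendsto_atTop))
  obtain ⟨j, hj, hjκ⟩ := (hgood.and
    ((tendsto_natCast_atTop_atTop.comp hψ.tendsto_atTop).eventually_ge_atTop κ)).exists
  exact ((hbad (ψ j)).trans_le hj).not_ge (mul_le_mul_of_nonneg_right hjκ (norm_nonneg _))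

end Lojasiewicz

theorem not_tendsto_zero_of_tendsto_average {R : ℕ → ℝ} {ρ : ℝ} (hρ : ρ ≠ 0)
    (h : Tendsto (fun t : ℕ => (∑ s ∈ Finset.range t, R s) / (t : ℝ)) atTop (𝓝 ρ)) :
    ¬ Tendsto R atTop (𝓝 0) := fun hR =>
  hρ (tendsto_nhds_unique h (by simpa only [div_eq_inv_mul] using hR.cesaro))

namespace IsDescentPath

section Hilbert

variable {F : Type*} [NormedAddCommGroup F] [InnerProductSpace ℝ F] [CompleteSpace F]
  {c : DescentConstants} {ρ : ℝ} {f : F → ℝ} {R : ℕ → ℝ} {x : ℕ → F} {l : ℝ} {p : F}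

theorem gradient_eq_zero_of_tendsto (h : IsDescentPath c ρ f R x) (hρ : 0 < ρ)
    (hf' : ContinuousAt (gradient f) p) (hl : Tendsto (fun t => f (x t)) atTop (𝓝 l))
    (hp : Tendsto x atTop (𝓝 p)) : gradient f p = 0 := by
  by_contra hne
  have hnorm : Tendsto (fun t => ‖gradient f (x t)‖ ^ 2) atTop (𝓝 (‖gradient f p‖ ^ 2)) :=
    (hf'.tendsto.comp hp).norm.pow 2
  have hne' : ‖gradient f p‖ ^ 2 ≠ 0 := pow_ne_zero 2 (norm_ne_zero_iff.2 hne)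
  refine not_tendsto_zero_of_tendsto_average hρ.ne' h.tendsto_average ?_
  have hquot := (h.tendsto_mul_norm_gradient_sq hl).div hnorm hne'
  rw [zero_div] at hquot
  refine hquot.congr' ?_
  filter_upwards [hnorm.eventually_ne hne'] with t ht
  exact mul_div_cancel_right₀ _ ht

end Hilbert

variable {n : ℕ} {c : DescentConstants} {ρ θ : ℝ} {f : EuclideanSpace ℝ (Fin n) → ℝ} {R : ℕ → ℝ}
  {x : ℕ → EuclideanSpace ℝ (Fin n)}

theorem exists_tendsto_apply_of_isBounded (h : IsDescentPath c ρ f R x) (hf : Continuous f)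
    (hx : Bornology.IsBounded (Set.range x)) :
    ∃ l, Tendsto (fun t => f (x t)) atTop (𝓝 l) := by
  refine h.exists_tendsto_apply ((hx.isCompact_closure.bddBelow_image hf.continuousOn).mono ?_)
  rintro _ ⟨t, rfl⟩
  exact Set.mem_image_of_mem f (subset_closure (Set.mem_range_self t))

theorem cauchySeq (h : IsDescentPath c ρ f R x) (hρ : 0 < ρ) (hθ : θ ∈ Set.Ioo (0 : ℝ) 1)
    (hloj : IsLojasiewicz f θ) (hf' : Continuous (gradient f))
    (hx : Bornology.IsBounded (Set.range x)) : CauchySeq x := by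
  obtain ⟨l, hl⟩ := h.exists_tendsto_apply_of_isBounded hloj.1.continuous hx
  rcases le_or_gt θ (1 / 2) with hle | hlt
  · obtain ⟨K, hK⟩ :=
      (hloj.mono hθ.1.le hle).exists_eventually_of_isBounded hf' (by norm_num) hx hl
    exact h.cauchySeq_of_lojasiewicz_half hρ hl hK
  · obtain ⟨K, hK⟩ := hloj.exists_eventually_of_isBounded hf' hθ.1.le hx hl
    obtain ⟨C, hC⟩ := h.exists_dist_le_rpow hρ ⟨hlt, hθ.2⟩ hl hK
    exact cauchySeq_of_dist_le_rpow (div_pos (by linarith [hθ.2]) (by linarith)) hC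

theorem exists_tendsto_critical (h : IsDescentPath c ρ f R x) (hρ : 0 < ρ)
    (hθ : θ ∈ Set.Ioo (0 : ℝ) 1) (hloj : IsLojasiewicz f θ) (hf' : Continuous (gradient f))
    (hx : Bornology.IsBounded (Set.range x)) :
    ∃ p, Tendsto x atTop (𝓝 p) ∧ gradient f p = 0 := by
  obtain ⟨l, hl⟩ := h.exists_tendsto_apply_of_isBounded hloj.1.continuous hx
  obtain ⟨p, hp⟩ := cauchySeq_tendsto_of_complete (h.cauchySeq hρ hθ hloj hf' hx)
  exact ⟨p, hp, h.gradient_eq_zero_of_tendsto hρ hf'.continuousAt hl hp⟩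

end IsDescentPath

section Stiefel

variable {n k : ℕ}

theorem orthonormal_frameOf (hkn : k ≤ n) (U : Matrix.orthogonalGroup (Fin n) ℝ) :
    Orthonormal ℝ (frameOf hkn U) := by
  refine orthonormal_iff_ite.2 fun i j => ?_
  have hcol := congrFun₂ ((Matrix.mem_orthogonalGroup_iff' (Fin n) ℝ).1 U.2)
    (Fin.castLE hkn j) (Fin.castLE hkn i)
  simpa [frameOf, Matrix.mul_apply, Matrix.one_apply, PiLp.inner_apply, eq_comm] using hcol

theorem measurable_frameOf (hkn : k ≤ n) : Measurable (frameOf (n := n) hkn) := by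
  refine Continuous.measurable (continuous_pi fun i => ?_)
  exact (PiLp.continuous_toLp 2 _).comp
    (continuous_pi fun r => (continuous_apply_apply r _).comp continuous_subtype_val)

instance isProbabilityMeasure_stiefelUniform (hkn : k ≤ n) :
    IsProbabilityMeasure (stiefelUniform (n := n) hkn) := by
  have : IsProbabilityMeasure (Measure.haarMeasure
      (⊤ : TopologicalSpace.PositiveCompacts (Matrix.orthogonalGroup (Fin n) ℝ))) :=
    ⟨Measure.haarMeasure_self⟩
  exact Measure.isProbabilityMeasure_map (measurable_frameOf hkn).aemeasurable

theorem measurableSet_setOf_orthonormal :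
    MeasurableSet {v : Fin k → EuclideanSpace ℝ (Fin n) | Orthonormal ℝ v} := by
  simp only [orthonormal_iff_ite, Set.ofPred_forall]
  exact .iInter fun i => .iInter fun j =>
    (isClosed_eq (by fun_prop) continuous_const).measurableSet

theorem ae_orthonormal_stiefelUniform (hkn : k ≤ n) :
    ∀ᵐ v ∂stiefelUniform hkn, Orthonormal ℝ v :=
  (ae_map_iff (measurable_frameOf hkn).aemeasurable measurableSet_setOf_orthonormal).2
    (.of_forall (orthonormal_frameOf hkn))

/-- The matrix of a linear isometry of `ℝⁿ` in the standard basis, by which the isometry acts on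
orthogonal matrices and hence on the frames of their columns. -/
noncomputable def isometryMatrix
    (φ : EuclideanSpace ℝ (Fin n) ≃ₗᵢ[ℝ] EuclideanSpace ℝ (Fin n)) :
    Matrix.orthogonalGroup (Fin n) ℝ :=
  ⟨_, φ.toMatrix_mem_unitaryGroup (EuclideanSpace.basisFun (Fin n) ℝ)
    (EuclideanSpace.basisFun (Fin n) ℝ)⟩

theorem frameOf_isometryMatrix_mul (hkn : k ≤ n)
    (φ : EuclideanSpace ℝ (Fin n) ≃ₗᵢ[ℝ] EuclideanSpace ℝ (Fin n))
    (U : Matrix.orthogonalGroup (Fin n) ℝ) (i : Fin k) :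
    frameOf hkn (isometryMatrix φ * U) i = φ (frameOf hkn U i) := by
  have hφ : Matrix.toEuclideanLin (isometryMatrix φ : Matrix (Fin n) (Fin n) ℝ) =
      φ.toLinearEquiv.toLinearMap := by
    rw [Matrix.toEuclideanLin_eq_toLin_orthonormal]
    exact Matrix.toLin_toMatrix _ _ _
  refine Eq.trans ?_ (LinearMap.congr_fun hφ (frameOf hkn U i))
  rw [frameOf, Matrix.toLpLin_apply]
  rfl

theorem map_isometry_stiefelUniform (hkn : k ≤ n)
    (φ : EuclideanSpace ℝ (Fin n) ≃ₗᵢ[ℝ] EuclideanSpace ℝ (Fin n)) :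
    (stiefelUniform hkn).map (fun (v : Fin k → EuclideanSpace ℝ (Fin n)) i => φ (v i)) =
      stiefelUniform hkn := by
  have hφ : Measurable fun (v : Fin k → EuclideanSpace ℝ (Fin n)) i => φ (v i) := by fun_prop
  have hframe : (fun (v : Fin k → EuclideanSpace ℝ (Fin n)) i => φ (v i)) ∘ frameOf hkn =
      frameOf hkn ∘ (isometryMatrix φ * ·) :=
    funext fun U => funext fun i => (frameOf_isometryMatrix_mul hkn φ U i).symm
  rw [stiefelUniform, Measure.map_map hφ (measurable_frameOf hkn), hframe,
    ← Measure.map_map (measurable_frameOf hkn) (measurable_const_mul _), map_mul_left_eq_self]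

theorem measurable_projSq :
    Measurable fun p : (Fin k → EuclideanSpace ℝ (Fin n)) × EuclideanSpace ℝ (Fin n) =>
      projSq p.1 p.2 := by
  unfold projSq
  fun_prop

theorem measurable_projSq_left (u : EuclideanSpace ℝ (Fin n)) :
    Measurable fun v : Fin k → EuclideanSpace ℝ (Fin n) => projSq v u :=
  measurable_projSq.of_uncurry_right

theorem map_projSq_stiefelUniform_eq (hkn : k ≤ n) {u w : EuclideanSpace ℝ (Fin n)}
    (h : ‖u‖ = ‖w‖) : (stiefelUniform hkn).map (fun v => projSq v u) =
      (stiefelUniform hkn).map (fun v => projSq v w) := by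
  set φ := (Submodule.span ℝ {u - w})ᗮ.reflection
  have hφ : φ.symm w = u := φ.symm_apply_eq.2 (Submodule.reflection_sub h).symm
  have hmeas : Measurable fun (v : Fin k → EuclideanSpace ℝ (Fin n)) i => φ (v i) := by fun_prop
  conv_rhs => rw [← map_isometry_stiefelUniform hkn φ]
  rw [Measure.map_map (measurable_projSq_left w) hmeas, ← hφ]
  congr 1 with v
  exact (projSq_comp_linearIsometryEquiv φ v w).symm

theorem integrable_projSq_stiefelUniform (hkn : k ≤ n) (u : EuclideanSpace ℝ (Fin n)) :
    Integrable (fun v => projSq v u) (stiefelUniform (k := k) hkn) := by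
  refine .of_bound (measurable_projSq_left u).aestronglyMeasurable (‖u‖ ^ 2) ?_
  filter_upwards [ae_orthonormal_stiefelUniform hkn] with v hv
  rw [Real.norm_of_nonneg (projSq_nonneg _ _)]
  exact projSq_le_norm_sq hv u

theorem integral_projSq_stiefelUniform_eq (hkn : k ≤ n) {u w : EuclideanSpace ℝ (Fin n)}
    (h : ‖u‖ = ‖w‖) : ∫ v, projSq v u ∂stiefelUniform (k := k) hkn =
      ∫ v, projSq v w ∂stiefelUniform hkn :=
  IdentDistrib.integral_eq ⟨(measurable_projSq_left u).aemeasurable,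
    (measurable_projSq_left w).aemeasurable, map_projSq_stiefelUniform_eq hkn h⟩

theorem mul_integral_projSq_stiefelUniform (hkn : k ≤ n) {e : EuclideanSpace ℝ (Fin n)}
    (he : ‖e‖ = 1) : n * ∫ v, projSq v e ∂stiefelUniform (k := k) hkn = k := by
  set b := EuclideanSpace.basisFun (Fin n) ℝ
  calc n * ∫ v, projSq v e ∂stiefelUniform (k := k) hkn
      = ∑ j, ∫ v, projSq v (b j) ∂stiefelUniform (k := k) hkn := by
        simp only [fun j => integral_projSq_stiefelUniform_eq (k := k) hkn
          ((b.norm_eq_one j).trans he.symm), Finset.sum_const, Finset.card_univ,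
          Fintype.card_fin, nsmul_eq_mul]
    _ = ∫ v, ∑ j, projSq v (b j) ∂stiefelUniform (k := k) hkn :=
        (integral_finsetSum _ fun j _ => integrable_projSq_stiefelUniform hkn (b j)).symm
    _ = ∫ _, (k : ℝ) ∂stiefelUniform (k := k) hkn :=
        integral_congr_ae <| (ae_orthonormal_stiefelUniform hkn).mono fun v hv =>
          by simp [sum_projSq_orthonormalBasis, hv.1]
    _ = k := by simp

theorem integral_projSq_stiefelUniform_pos (hk : 0 < k) (hkn : k ≤ n)
    {e : EuclideanSpace ℝ (Fin n)} (he : ‖e‖ = 1) :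
    0 < ∫ v, projSq v e ∂stiefelUniform hkn := by
  have hmean : (0 : ℝ) < n * ∫ v, projSq v e ∂stiefelUniform hkn := by
    rw [mul_integral_projSq_stiefelUniform hkn he]
    exact_mod_cast hk
  exact pos_of_mul_pos_right hmean n.cast_nonneg

end Stiefel

section Freezing

variable {Ω α β γ : Type*} {m mΩ : MeasurableSpace Ω} {mα : MeasurableSpace α}
  {mβ : MeasurableSpace β} {mγ : MeasurableSpace γ} {P : Measure Ω} [IsProbabilityMeasure P]
  {X : Ω → α} {Y : Ω → β} {g : β → α → γ} {ν : Measure γ}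

theorem map_prodMk_eq_prod_of_forall_map_eq (hX : Measurable X) (hY : Measurable Y)
    (hXY : Y ⟂ᵢ[P] X) (hg : Measurable (Function.uncurry g))
    (hν : ∀ y, (P.map X).map (g y) = ν) :
    P.map (fun ω => (Y ω, g (Y ω) (X ω))) = (P.map Y).prod ν := by
  have := Measure.isProbabilityMeasure_map (μ := P) hX.aemeasurable
  have := Measure.isProbabilityMeasure_map (μ := P) hY.aemeasurable
  have hskew := (MeasurePreserving.id (P.map Y)).skew_product hg (ae_of_all _ hν)
  rw [← hskew.map_eq, ← (indepFun_iff_map_prod_eq_prod_map_map hY.aemeasurable hX.aemeasurable).1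
    hXY, Measure.map_map hskew.measurable (hY.prodMk hX)]
  rfl

variable [SFinite ν]

theorem map_eq_of_forall_map_eq (hX : Measurable X) (hY : Measurable Y) (hXY : Y ⟂ᵢ[P] X)
    (hg : Measurable (Function.uncurry g)) (hν : ∀ y, (P.map X).map (g y) = ν) :
    P.map (fun ω => g (Y ω) (X ω)) = ν := by
  have := Measure.isProbabilityMeasure_map (μ := P) hY.aemeasurable
  have hprod := congrArg Measure.snd (map_prodMk_eq_prod_of_forall_map_eq hX hY hXY hg hν)
  rwa [Measure.snd_prod, Measure.snd_map_prodMk hY] at hprod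

theorem indepFun_of_forall_map_eq (hX : Measurable X) (hY : Measurable Y) (hXY : Y ⟂ᵢ[P] X)
    (hg : Measurable (Function.uncurry g)) (hν : ∀ y, (P.map X).map (g y) = ν) :
    Y ⟂ᵢ[P] fun ω => g (Y ω) (X ω) := by
  have hgYX : Measurable fun ω => g (Y ω) (X ω) := hg.comp (hY.prodMk hX)
  rw [indepFun_iff_map_prod_eq_prod_map_map hY.aemeasurable hgYX.aemeasurable,
    map_eq_of_forall_map_eq hX hY hXY hg hν]
  exact map_prodMk_eq_prod_of_forall_map_eq hX hY hXY hg hν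

theorem indep_comap_of_forall_map_eq (hm : m ≤ mΩ) (hX : Measurable X)
    (hindep : Indep m (MeasurableSpace.comap X inferInstance) P) (hY : Measurable[m] Y)
    (hg : Measurable (Function.uncurry g)) (hν : ∀ y, (P.map X).map (g y) = ν) :
    Indep m (MeasurableSpace.comap (fun ω => g (Y ω) (X ω)) inferInstance) P := by
  have hid : Measurable[mΩ, m] (id : Ω → Ω) := measurable_id'' hm
  have hidX : @IndepFun Ω Ω α mΩ m _ id X P := by
    rwa [@IndepFun_iff_Indep _ _ _ _ m, MeasurableSpace.comap_id]
  have hgY : Measurable[m.prod mα] (Function.uncurry fun ω => g (Y ω)) :=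
    hg.comp (@Measurable.prodMap _ _ _ _ m mβ mα mα _ _ hY measurable_id)
  have hind := @indepFun_of_forall_map_eq Ω α Ω γ mΩ mα m mγ P _ X id (fun ω => g (Y ω)) ν _
    hX hid hidX hgY fun ω => hν (Y ω)
  rwa [@IndepFun_iff_Indep _ _ _ _ m, MeasurableSpace.comap_id] at hind

end Freezing

section Past

variable {Ω E : Type*} {mΩ : MeasurableSpace Ω} [MeasurableSpace E] {P : Measure Ω}
  {V : ℕ → Ω → E} {R : ℕ → Ω → ℝ}

/-- The filtration of the events that are determined by the values of the process `V` strictly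
before time `t`, whereas `Filtration.natural` includes the value at time `t`. -/
def pastFiltration (V : ℕ → Ω → E) (hV : ∀ t, Measurable (V t)) : Filtration ℕ mΩ where
  seq t := ⨆ s ∈ Set.Iio t, MeasurableSpace.comap (V s) inferInstance
  mono' _ _ hst := biSup_mono fun _ hr => lt_of_lt_of_le hr hst
  le' _ := iSup₂_le fun s _ => (hV s).comap_le

theorem measurable_pastFiltration (hV : ∀ t, Measurable (V t)) {s t : ℕ} (hst : s < t) :
    Measurable[pastFiltration V hV t] (V s) :=
  measurable_iff_comap_le.2 <|
    le_iSup₂ (f := fun s (_ : s ∈ Set.Iio t) => MeasurableSpace.comap (V s) inferInstance) s hst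

theorem indep_pastFiltration (hV : ∀ t, Measurable (V t)) (hindep : iIndepFun V P) (t : ℕ) :
    Indep (pastFiltration V hV t) (MeasurableSpace.comap (V t) inferInstance) P := by
  have hdisj : Disjoint (Set.Iio t) {t} := by simp
  have := indep_iSup_of_disjoint (fun s => (hV s).comap_le) hindep hdisj
  rwa [iSup_singleton] at this

theorem pairwise_indepFun_of_indep_filtration {ℱ : Filtration ℕ mΩ}
    (hR : ∀ t, Measurable[ℱ (t + 1)] (R t))
    (hindep : ∀ t, Indep (ℱ t) (MeasurableSpace.comap (R t) inferInstance) P) :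
    Pairwise fun s t => R s ⟂ᵢ[P] R t := by
  have : Std.Symm fun s t => R s ⟂ᵢ[P] R t := ⟨fun _ _ h => h.symm⟩
  refine Pairwise.of_lt fun s t hst => ?_
  rw [IndepFun_iff_Indep]
  exact indep_of_indep_of_le_left (hindep t) ((hR s).mono (ℱ.mono hst) le_rfl).comap_le

theorem ae_tendsto_average_of_forall_map_eq [IsProbabilityMeasure P] {β : Type*}
    [MeasurableSpace β] {Y : ℕ → Ω → β} {g : β → E → ℝ} {ν : Measure ℝ} [SFinite ν]
    (hV : ∀ t, Measurable (V t)) (hindep : iIndepFun V P)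
    (hY : ∀ t, Measurable[pastFiltration V hV t] (Y t)) (hg : Measurable (Function.uncurry g))
    (hν : ∀ t y, (P.map (V t)).map (g y) = ν) (hint : Integrable id ν) :
    ∀ᵐ ω ∂P, Tendsto (fun t : ℕ => (∑ s ∈ Finset.range t, g (Y s ω) (V s ω)) / (t : ℝ)) atTop
      (𝓝 (∫ r, r ∂ν)) := by
  have hYm : ∀ t, Measurable (Y t) := fun t => (hY t).mono ((pastFiltration V hV).le t) le_rfl
  have hpast : ∀ t, Y t ⟂ᵢ[P] V t := fun t => (IndepFun_iff_Indep _ _ _).2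
    (indep_of_indep_of_le_left (indep_pastFiltration hV hindep t) (hY t).comap_le)
  have hindepR : Pairwise fun s t => (fun ω => g (Y s ω) (V s ω)) ⟂ᵢ[P] fun ω =>
      g (Y t ω) (V t ω) :=
    pairwise_indepFun_of_indep_filtration (ℱ := pastFiltration V hV)
      (fun t => hg.comp (((hY t).mono ((pastFiltration V hV).mono t.le_succ) le_rfl).prodMk
        (measurable_pastFiltration hV t.lt_succ_self)))
      fun t => indep_comap_of_forall_map_eq ((pastFiltration V hV).le t) (hV t)
        (indep_pastFiltration hV hindep t) (hY t) hg (hν t)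
  have hlaw : ∀ t, IdentDistrib (fun ω => g (Y t ω) (V t ω)) id P ν := fun t =>
    ⟨(hg.comp ((hYm t).prodMk (hV t))).aemeasurable, aemeasurable_id, by
      rw [Measure.map_id, map_eq_of_forall_map_eq (hV t) (hYm t) (hpast t) hg (hν t)]⟩
  have hmean := (hlaw 0).integral_eq
  simp only [id_eq] at hmean
  rw [← hmean]
  exact strong_law_ae_real (fun t ω => g (Y t ω) (V t ω)) ((hlaw 0).integrable_iff.2 hint)
    hindepR fun t => (hlaw t).trans (hlaw 0).symm

end Past

section UnitDirection

variable {E : Type*} [NormedAddCommGroup E] [NormedSpace ℝ E]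

/-- The direction of `w`. The vector `e` replaces it if `w = 0`, so that the result is always a unit
vector when `e` is one. -/
noncomputable def unitDirection (e w : E) : E :=
  open Classical in if w = 0 then e else ‖w‖⁻¹ • w

theorem measurable_unitDirection [MeasurableSpace E] [BorelSpace E] [SecondCountableTopology E]
    (e : E) : Measurable (unitDirection e) :=
  Measurable.ite (measurableSet_singleton 0) measurable_const
    (measurable_norm.inv.smul measurable_id)

theorem norm_unitDirection {e : E} (he : ‖e‖ = 1) (w : E) : ‖unitDirection e w‖ = 1 := by
  unfold unitDirection
  split_ifs with hw
  · exact he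
  · exact norm_smul_inv_norm (𝕜 := ℝ) hw

theorem norm_smul_unitDirection (e w : E) : ‖w‖ • unitDirection e w = w := by
  unfold unitDirection
  split_ifs with hw
  · rw [hw, norm_zero, zero_smul]
  · exact smul_inv_smul₀ (norm_ne_zero_iff.2 hw) w

end UnitDirection

section RandomFrames

variable {Ω : Type*} {mΩ : MeasurableSpace Ω} {P : Measure Ω} {n k : ℕ}
  {hkn : k ≤ n} {V : ℕ → Ω → Fin k → EuclideanSpace ℝ (Fin n)}
  {Y : ℕ → Ω → EuclideanSpace ℝ (Fin n)} {e : EuclideanSpace ℝ (Fin n)}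

theorem ae_forall_orthonormal (hV : ∀ t, Measurable (V t))
    (hlaw : ∀ t, P.map (V t) = stiefelUniform hkn) : ∀ᵐ ω ∂P, ∀ t, Orthonormal ℝ (V t ω) :=
  ae_all_iff.2 fun t =>
    ae_of_ae_map (hV t).aemeasurable ((hlaw t).symm ▸ ae_orthonormal_stiefelUniform hkn)

theorem ae_tendsto_average_projSq_unitDirection [IsProbabilityMeasure P]
    (hV : ∀ t, Measurable (V t))
    (hlaw : ∀ t, P.map (V t) = stiefelUniform hkn) (hindep : iIndepFun V P)
    (hY : ∀ t, Measurable[pastFiltration V hV t] (Y t)) (he : ‖e‖ = 1) :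
    ∀ᵐ ω ∂P, Tendsto
      (fun t : ℕ => (∑ s ∈ Finset.range t, projSq (V s ω) (unitDirection e (Y s ω))) / (t : ℝ))
      atTop (𝓝 (∫ v, projSq v e ∂stiefelUniform hkn)) := by
  have hmeas := (measurable_projSq_left (k := k) e).aemeasurable (μ := stiefelUniform hkn)
  have hmean : ∫ r, r ∂(stiefelUniform hkn).map (fun v => projSq v e) =
      ∫ v, projSq v e ∂stiefelUniform hkn := integral_map hmeas aestronglyMeasurable_id
  rw [← hmean]
  have hdir : Measurable fun p : EuclideanSpace ℝ (Fin n) × (Fin k → EuclideanSpace ℝ (Fin n)) =>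
      unitDirection e p.1 := (measurable_unitDirection e).comp measurable_fst
  have hg := measurable_projSq.comp (measurable_snd.prodMk hdir)
  have hν : ∀ t y, (P.map (V t)).map (fun v => projSq v (unitDirection e y)) =
      (stiefelUniform hkn).map fun v => projSq v e := fun t y => by
    rw [hlaw, map_projSq_stiefelUniform_eq hkn ((norm_unitDirection he y).trans he.symm)]
  have hint := (integrable_map_measure aestronglyMeasurable_id hmeas).2
    (integrable_projSq_stiefelUniform hkn e)
  exact ae_tendsto_average_of_forall_map_eq (g := fun y v => projSq v (unitDirection e y)) hV
    hindep hY hg hν hint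

end RandomFrames

section Iterates

variable {Ω : Type*} {mΩ : MeasurableSpace Ω} {P : Measure Ω} [IsProbabilityMeasure P] {n k : ℕ}
  {f : EuclideanSpace ℝ (Fin n) → ℝ} {L η δ₀ : ℝ} {x₀ : EuclideanSpace ℝ (Fin n)}
  {V : ℕ → Ω → Fin k → EuclideanSpace ℝ (Fin n)}

theorem continuous_gradEst (hf : Continuous f) (δ : ℝ) :
    Continuous fun p : (Fin k → EuclideanSpace ℝ (Fin n)) × EuclideanSpace ℝ (Fin n) =>
      gradEst f δ p.1 p.2 := by
  unfold gradEst
  fun_prop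

theorem measurable_pastFiltration_szgd (hf : Continuous f) (hV : ∀ t, Measurable (V t)) (t : ℕ) :
    Measurable[pastFiltration V hV t] fun ω => szgd f η δ₀ x₀ (fun s => V s ω) t := by
  induction t with
  | zero => exact measurable_const
  | succ t ih =>
    have hx := ih.mono ((pastFiltration V hV).mono t.le_succ) le_rfl
    exact hx.sub (((continuous_gradEst hf _).measurable.comp
      ((measurable_pastFiltration hV t.lt_succ_self).prodMk hx)).const_smul η)

theorem IsLSmooth.exists_ae_isDescentPath (hk : 0 < k) (hkn : k ≤ n) (hL : 0 < L)
    (hf : IsLSmooth f L) (hη : η ∈ Set.Ioo (0 : ℝ) (2 * k / (L * n))) (hδ₀ : 0 < δ₀)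
    (x₀ : EuclideanSpace ℝ (Fin n)) (hV : ∀ t, Measurable (V t))
    (hlaw : ∀ t, P.map (V t) = stiefelUniform hkn) (hindep : iIndepFun V P) :
    ∃ (c : DescentConstants) (ρ : ℝ), 0 < ρ ∧ ∀ᵐ ω ∂P, ∃ R : ℕ → ℝ,
      IsDescentPath c ρ f R (szgd f η δ₀ x₀ fun s => V s ω) := by
  obtain ⟨c, hc⟩ := hf.exists_descentConstants_szgd hk hkn hL hη hδ₀
  obtain ⟨e, he⟩ : ∃ e : EuclideanSpace ℝ (Fin n), ‖e‖ = 1 :=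
    ⟨EuclideanSpace.basisFun (Fin n) ℝ ⟨0, hk.trans_le hkn⟩, OrthonormalBasis.norm_eq_one _ _⟩
  set y : ℕ → Ω → EuclideanSpace ℝ (Fin n) :=
    fun t ω => gradient f (szgd f η δ₀ x₀ (fun s => V s ω) t)
  have hy : ∀ t, Measurable[pastFiltration V hV t] (y t) := fun t =>
    hf.continuous_gradient.measurable.comp (measurable_pastFiltration_szgd hf.1.continuous hV t)
  refine ⟨c, ∫ v, projSq v e ∂stiefelUniform hkn, integral_projSq_stiefelUniform_pos hk hkn he, ?_⟩
  filter_upwards [ae_forall_orthonormal hV hlaw,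
    ae_tendsto_average_projSq_unitDirection hV hlaw hindep hy he] with ω hω havg
  have hproj : ∀ t, projSq (V t ω) (y t ω) =
      projSq (V t ω) (unitDirection e (y t ω)) * ‖y t ω‖ ^ 2 := fun t => by
    rw [mul_comm, ← projSq_smul, norm_smul_unitDirection]
  refine ⟨fun t => projSq (V t ω) (unitDirection e (y t ω)),
    fun t => ⟨projSq_nonneg _ _, ?_⟩, havg, fun t => ?_, fun t => ?_⟩
  · simpa only [norm_unitDirection he, one_pow] using
      projSq_le_norm_sq (hω t) (unitDirection e (y t ω))
  · rw [← hproj]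
    exact (hc x₀ (fun s => V s ω) t (hω t)).1
  · rw [← hproj]
    exact (hc x₀ (fun s => V s ω) t (hω t)).2

end Iterates

theorem exists_measurable_ae_tendsto_and {Ω E : Type*} {mΩ : MeasurableSpace Ω} {P : Measure Ω}
    [TopologicalSpace E] [TopologicalSpace.PseudoMetrizableSpace E] [T2Space E]
    [MeasurableSpace E] [BorelSpace E] {x : ℕ → Ω → E} {q : E → Prop}
    (hx : ∀ t, Measurable (x t))
    (h : ∀ᵐ ω ∂P, ∃ p, Tendsto (fun t => x t ω) atTop (𝓝 p) ∧ q p) :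
    ∃ y : Ω → E, Measurable y ∧
      ∀ᵐ ω ∂P, Tendsto (fun t => x t ω) atTop (𝓝 (y ω)) ∧ q (y ω) := by
  obtain ⟨y, hy, hlim⟩ := measurable_limit_of_tendsto_metrizable_ae
    (fun t => (hx t).aemeasurable) (h.mono fun ω ⟨p, hp, _⟩ => ⟨p, hp⟩)
  refine ⟨y, hy, ?_⟩
  filter_upwards [hlim, h] with ω hω ⟨p, hp, hq⟩
  exact ⟨hω, tendsto_nhds_unique hp hω ▸ hq⟩

namespace IsDescentPath

variable {n : ℕ} {c : DescentConstants} {ρ θ κ : ℝ} {f : EuclideanSpace ℝ (Fin n) → ℝ}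
  {R : ℕ → ℝ} {x : ℕ → EuclideanSpace ℝ (Fin n)} {p : EuclideanSpace ℝ (Fin n)}

theorem tendsto_linearRate_pow_mul_norm_sub (h : IsDescentPath c ρ f R x) (hρ : 0 < ρ)
    (hf : ContinuousAt f p) (hθ : θ ∈ Set.Icc (0 : ℝ) (1 / 2)) (hloj : LojasiewiczAt f θ κ p)
    (hp : Tendsto x atTop (𝓝 p)) :
    Tendsto (fun t : ℕ => linearRate c ρ κ ^ t * ‖x t - p‖) atTop (𝓝 0) := by
  have hl := hf.tendsto.comp hp
  simpa only [dist_eq_norm] using h.tendsto_linearRate_pow_mul_dist hρ hl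
    ((hloj.mono hf hθ.1 hθ.2).eventually_of_tendsto hf hp hl) hp

theorem isBigO_norm_sub (h : IsDescentPath c ρ f R x) (hρ : 0 < ρ) (hf : ContinuousAt f p)
    (hθ : θ ∈ Set.Ioo (1 / 2 : ℝ) 1) (hloj : LojasiewiczAt f θ κ p)
    (hp : Tendsto x atTop (𝓝 p)) :
    (fun t => ‖x t - p‖) =O[atTop] fun t : ℕ => (t : ℝ) ^ ((1 - θ) / (1 - 2 * θ)) := by
  have hl := hf.tendsto.comp hp
  simpa only [dist_eq_norm] using
    h.isBigO_dist hρ hθ hl (hloj.eventually_of_tendsto hf hp hl) hp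

end IsDescentPath

theorem theorem5_general {Ω : Type*} [MeasurableSpace Ω] (P : Measure Ω) [IsProbabilityMeasure P]
    {n k : ℕ} (hk : 0 < k) (hkn : k ≤ n)
    (f : EuclideanSpace ℝ (Fin n) → ℝ) (L θ : ℝ) (hL : 0 < L) (hsmooth : IsLSmooth f L)
    (hθ : θ ∈ Set.Ioo (0 : ℝ) 1) (hloj : IsLojasiewicz f θ)
    (η δ₀ : ℝ) (hη : η ∈ Set.Ioo (0 : ℝ) (2 * k / (L * n))) (hδ₀ : 0 < δ₀)
    (x₀ : EuclideanSpace ℝ (Fin n))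
    (V : ℕ → Ω → Fin k → EuclideanSpace ℝ (Fin n)) (hVmeas : ∀ t, Measurable (V t))
    (hVlaw : ∀ t, P.map (V t) = stiefelUniform hkn) (hVindep : iIndepFun V P)
    (x : ℕ → Ω → EuclideanSpace ℝ (Fin n))
    (hx : ∀ t ω, x t ω = szgd f η δ₀ x₀ (fun s => V s ω) t)
    (hxbdd : ∀ᵐ ω ∂P, Bornology.IsBounded (Set.range fun t => x t ω)) :
    ∃ xlim : Ω → EuclideanSpace ℝ (Fin n), Measurable xlim ∧
      (∀ᵐ ω ∂P, Tendsto (fun t => x t ω) atTop (𝓝 (xlim ω)) ∧ gradient f (xlim ω) = 0) ∧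
      (θ ≤ 1 / 2 →
        (∀ κ : ℝ, IsLojasiewiczWith f θ κ →
          ∃ Q : ℝ, 1 < Q ∧ ∀ᵐ ω ∂P,
            Tendsto (fun t : ℕ => Q ^ t * ‖x t ω - xlim ω‖) atTop (𝓝 0)) ∧
        (∀ᵐ ω ∂P, ∃ Q : ℝ, 1 < Q ∧
            Tendsto (fun t : ℕ => Q ^ t * ‖x t ω - xlim ω‖) atTop (𝓝 0))) ∧
      (1 / 2 < θ →
        ∀ᵐ ω ∂P, (fun t : ℕ => ‖x t ω - xlim ω‖) =O[atTop]
          (fun t : ℕ => (t : ℝ) ^ ((1 - θ) / (1 - 2 * θ)))) := by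
  obtain ⟨c, ρ, hρ, hpath⟩ :=
    hsmooth.exists_ae_isDescentPath hk hkn hL hη hδ₀ x₀ hVmeas hVlaw hVindep
  have hxeq : ∀ ω, szgd f η δ₀ x₀ (fun s => V s ω) = fun t => x t ω :=
    fun ω => (funext fun t => hx t ω).symm
  simp only [hxeq] at hpath
  have hxmeas : ∀ t, Measurable (x t) := fun t => by
    rw [funext (hx t)]
    exact (measurable_pastFiltration_szgd hsmooth.1.continuous hVmeas t).mono
      ((pastFiltration V hVmeas).le t) le_rfl
  have hconv : ∀ᵐ ω ∂P, ∃ p, Tendsto (fun t => x t ω) atTop (𝓝 p) ∧ gradient f p = 0 := by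
    filter_upwards [hpath, hxbdd] with ω ⟨R, hR⟩ hω
    exact hR.exists_tendsto_critical hρ hθ hloj hsmooth.continuous_gradient hω
  obtain ⟨xlim, hmeas, hlim⟩ := exists_measurable_ae_tendsto_and hxmeas hconv
  have hf : ∀ p, ContinuousAt f p := fun p => hsmooth.1.continuous.continuousAt
  refine ⟨xlim, hmeas, hlim, fun hle => ⟨fun κ hκ => ⟨_, one_lt_linearRate c hρ κ, ?_⟩, ?_⟩,
    fun hlt => ?_⟩ <;> filter_upwards [hpath, hlim] with ω ⟨R, hR⟩ ⟨hp, hcrit⟩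
  · exact hR.tendsto_linearRate_pow_mul_norm_sub hρ (hf _) ⟨hθ.1.le, hle⟩ (hκ.2 _ hcrit) hp
  · obtain ⟨κ, -, hκ⟩ := hloj.2 _ hcrit
    exact ⟨_, one_lt_linearRate c hρ κ,
      hR.tendsto_linearRate_pow_mul_norm_sub hρ (hf _) ⟨hθ.1.le, hle⟩ hκ hp⟩
  · obtain ⟨κ, -, hκ⟩ := hloj.2 _ hcrit
    exact hR.isBigO_norm_sub hρ (hf _) ⟨hlt, hθ.2⟩ hκ hp

theorem theorem5 {Ω : Type*} [MeasurableSpace Ω] (P : Measure Ω) [IsProbabilityMeasure P]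
    {n k : ℕ} (hk : 0 < k) (hkn : k ≤ n)
    (f : EuclideanSpace ℝ (Fin n) → ℝ) (L θ : ℝ) (hL : 0 < L) (hsmooth : IsLSmooth f L)
    (hθ : θ ∈ Set.Ioo (0 : ℝ) 1) (hloj : IsLojasiewicz f θ)
    (hbdd : BddBelow (Set.range f))
    (η δ₀ : ℝ) (hη : η ∈ Set.Ioo (0 : ℝ) (2 * k / (L * n))) (hδ₀ : δ₀ ∈ Set.Ioc (0 : ℝ) 1)
    (x₀ : EuclideanSpace ℝ (Fin n))
    (V : ℕ → Ω → Fin k → EuclideanSpace ℝ (Fin n)) (hVmeas : ∀ t, Measurable (V t))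
    (hVlaw : ∀ t, P.map (V t) = stiefelUniform hkn) (hVindep : iIndepFun V P)
    (x : ℕ → Ω → EuclideanSpace ℝ (Fin n))
    (hx : ∀ t ω, x t ω = szgd f η δ₀ x₀ (fun s => V s ω) t)
    (hxbdd : ∀ᵐ ω ∂P, Bornology.IsBounded (Set.range fun t => x t ω)) :
    ∃ xlim : Ω → EuclideanSpace ℝ (Fin n), Measurable xlim ∧
      (∀ᵐ ω ∂P, Tendsto (fun t => x t ω) atTop (𝓝 (xlim ω)) ∧ gradient f (xlim ω) = 0) ∧
      (θ ∈ Set.Ioc (0 : ℝ) (1 / 2) →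
        -1 ≤ L * n * η ^ 2 / (2 * k) - η → L * n * η ^ 2 / (2 * k) - η < 0 →
          (∀ κ : ℝ, 0 < κ → IsLojasiewiczWith f θ κ →
            ∃ Q : ℝ, 1 < Q ∧ ∀ᵐ ω ∂P,
              Tendsto (fun t : ℕ => Q ^ t * ‖x t ω - xlim ω‖) atTop (𝓝 0)) ∧
          (∀ᵐ ω ∂P, ∃ Q : ℝ, 1 < Q ∧
              Tendsto (fun t : ℕ => Q ^ t * ‖x t ω - xlim ω‖) atTop (𝓝 0))) ∧
      (θ ∈ Set.Ioo (1 / 2 : ℝ) 1 →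
        ∀ᵐ ω ∂P, (fun t : ℕ => ‖x t ω - xlim ω‖) =O[atTop]
          (fun t : ℕ => (t : ℝ) ^ ((1 - θ) / (1 - 2 * θ)))) := by
  obtain ⟨xlim, hmeas, hlim, hlinear, hpower⟩ := theorem5_general P hk hkn f L θ hL hsmooth hθ hloj
    η δ₀ hη hδ₀.1 x₀ V hVmeas hVlaw hVindep x hx hxbdd
  exact ⟨xlim, hmeas, hlim, fun hle _ _ => ⟨fun κ _ => (hlinear hle.2).1 κ, (hlinear hle.2).2⟩,
    fun hlt => hpower hlt.1⟩
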